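/- Let $p>2$ and $p_k = \frac{1}{\zeta(p+1)\,k^{p+1}}$ for $k\ge 1$, where $\zeta(p+1)=\sum_{k\ge1}k^{-(p+1)}$. Let $\varepsilon_1,\varepsilon_2,\dots$ be i.i.d. random variables on a probability space $(\Omega,\mathcal A,\mathbb P)$ with $\mathbb P(\varepsilon_i=k)=p_k$ for $k\ge1$, let $W_0$ be an $\mathbb N$-valued random variable independent of $(\varepsilon_i)_{i\ge1}$ (here $0\in\mathbb N$), and define for $k\ge1$ $$W_k=(W_{k-1}-1)\mathbf 1_{\{W_{k-1}\ne0\}}+(\varepsilon_k-1)\mathbf 1_{\{W_{k-1}=0\}}.$$ Let $\nu$ be the stationary distribution of this Markov chain, $\nu_0=1/\mathbb E(\varepsilon_1)$ and $\nu_j=\nu_0\sum_{i\ge j+1}p_i$ for $j\ge1$. (a) Suppose that $W_0$ has law $\nu$. Let $W_0^*$ have law $\nu$ and be independent of $(W_0,(\varepsilon_i)_{i\ge1})$, let $(W_k^*)_{k\ge0}$ be the chain started at $W_0^*$ and driven by the same variables $(\varepsilon_i)_{i\ge1}$, and let $T^*=\inf\{k\ge0: W_k=W_k^*\}$ (with $\inf\emptyset=\infty$).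 Writing $\mathbb P_{\nu\otimes\nu}$ for the probability in this situation, $$\sum_{n\ge1}n^{p-2}\,\mathbb P_{\nu\otimes\nu}(T^*\ge n)=\infty,\qquad\text{and, for every }\epsilon>0,\quad \sum_{n\ge2}n^{p-2}(\log n)^{-(1+\epsilon)}\,\mathbb P_{\nu\otimes\nu}(T^*\ge n)<\infty .$$ (b) For every law of $W_0$ and every centered stationary Gaussian sequence $(g_k)_{k\in\mathbb Z}$ defined on the same probability space (with no assumption on its joint law with the chain) whose series of covariances $\sum_{k\ge0}\mathrm{Cov}(g_0,g_k)$ converges, $$\limsup_{n\to\infty}\,(n\log n)^{-1/p}\,\Big|\sum_{k=1}^n\big(\mathbf 1_{\{W_k=0\}}-\nu_0\big)-\sum_{k=1}^n g_k\Big|>0\quad\text{almost surely.}$$ -/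

import Mathlib

namespace DiscreteChain

open MeasureTheory ProbabilityTheory Filter Topology

/-- The innovation weights `p_k = 1 / (ζ(p+1) k^{p+1})`, `k ≥ 1`, with
`ζ(p+1) = ∑_{j ≥ 1} j^{-(p+1)}`; the weight of `0` is zero. -/
noncomputable def innovMass (p : ℝ) (k : ℕ) : ℝ :=
  if k = 0 then 0
  else 1 / ((∑' j : ℕ, ((j : ℝ) + 1) ^ (-(p + 1))) * (k : ℝ) ^ (p + 1))

/-- The stationary distribution of the chain: `ν_j = ν_0 ∑_{i ≥ j+1} p_i` with
`ν_0 = 1 / E(ε) = 1 / ∑_k k p_k` (for `j = 0` the sum over `i` is the total mass one). -/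
noncomputable def statMass (p : ℝ) (j : ℕ) : ℝ :=
  (1 / ∑' k : ℕ, (k : ℝ) * innovMass p k) * ∑' i : ℕ, innovMass p (i + j + 1)

/-- The transition probabilities: `P_{i,i-1} = 1` for `i ≥ 1`, and `P_{0,j} = p_{j+1}`. -/
noncomputable def transProb (p : ℝ) (i j : ℕ) : ℝ :=
  if i = 0 then innovMass p (j + 1) else if i = j + 1 then 1 else 0

/-- One step of the recursion: `F(e, w) = (w - 1) 1_{w ≠ 0} + (e - 1) 1_{w = 0}`. -/
def step (e w : ℕ) : ℕ := if w = 0 then e - 1 else w - 1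

/-- The chain started at `w₀` and driven by the innovations `e`, where `e k` is the innovation
used in the step from time `k` to time `k + 1`. -/
def chain (e : ℕ → ℕ) (w₀ : ℕ) : ℕ → ℕ
  | 0 => w₀
  | k + 1 => step (e k) (chain e w₀ k)

/-- The meeting time of the two chains which are started at `w₀` and at `w₀'` and driven by the
same innovations: `T^* = inf {k ≥ 0 : W_k = W_k^*}`, infinite if they never meet. -/
noncomputable def meetTime (e : ℕ → ℕ) (w₀ w₀' : ℕ) : ℕ∞ :=
  sInf {t : ℕ∞ | ∃ k : ℕ, t = (k : ℕ∞) ∧ chain e w₀ k = chain e w₀' k}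

/-- Strict stationarity of a real process indexed by the integers: its law on `ℤ → ℝ` is
invariant under all shifts. -/
def IsStationaryProcess {Ω : Type*} [MeasurableSpace Ω] (g : ℤ → Ω → ℝ) (P : Measure Ω) : Prop :=
  ∀ h : ℤ, IdentDistrib (fun ω (k : ℤ) => g (k + h) ω) (fun ω (k : ℤ) => g k ω) P P

section Checks

variable {p : ℝ}

theorem summable_zeta (hp : 2 < p) : Summable fun j : ℕ => ((j : ℝ) + 1) ^ (-(p + 1)) := by
  have h := (summable_nat_add_iff 1).2 (Real.summable_nat_rpow.2 (by linarith : -(p + 1) < -1))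
  simpa using h

theorem zeta_pos (hp : 2 < p) : 0 < ∑' j : ℕ, ((j : ℝ) + 1) ^ (-(p + 1)) :=
  (summable_zeta hp).tsum_pos (fun j => by positivity) 0 (by positivity)

theorem innovMass_succ (k : ℕ) : innovMass p (k + 1) =
    (∑' j : ℕ, ((j : ℝ) + 1) ^ (-(p + 1)))⁻¹ * ((k : ℝ) + 1) ^ (-(p + 1)) := by
  have : (0 : ℝ) ≤ (k : ℝ) + 1 := by positivity
  rw [Real.rpow_neg this]
  simp [innovMass, mul_comm]

theorem innovMass_nonneg (k : ℕ) : 0 ≤ innovMass p k := by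
  cases k with
  | zero => simp [innovMass]
  | succ k =>
    rw [innovMass_succ]
    have : 0 ≤ ∑' j : ℕ, ((j : ℝ) + 1) ^ (-(p + 1)) := tsum_nonneg fun j => by positivity
    positivity

/-- The innovation weights form a probability distribution on `{1, 2, …}`. -/
theorem hasSum_innovMass (hp : 2 < p) : HasSum (fun k : ℕ => innovMass p (k + 1)) 1 := by
  have h := (summable_zeta hp).hasSum.mul_left (∑' j : ℕ, ((j : ℝ) + 1) ^ (-(p + 1)))⁻¹
  rw [inv_mul_cancel₀ (zeta_pos hp).ne'] at h
  simpa only [innovMass_succ] using h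

theorem summable_mean (hp : 2 < p) :
    Summable fun k : ℕ => ((k : ℝ) + 1) * innovMass p (k + 1) := by
  have h := (summable_nat_add_iff 1).2 (Real.summable_nat_rpow.2 (by linarith : -p < -1))
  refine (h.mul_left (∑' j : ℕ, ((j : ℝ) + 1) ^ (-(p + 1)))⁻¹).congr fun k => ?_
  have hk : (0 : ℝ) < (k : ℝ) + 1 := by positivity
  rw [innovMass_succ, show -p = -(p + 1) + 1 by ring, Nat.cast_add, Nat.cast_one,
    Real.rpow_add_one hk.ne']
  ring

theorem hasSum_mean (hp : 2 < p) : HasSum (fun k : ℕ => ((k : ℝ) + 1) * innovMass p (k + 1))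
    (∑' k : ℕ, (k : ℝ) * innovMass p k) := by
  have h := summable_mean hp
  have h' : Summable fun k : ℕ => (k : ℝ) * innovMass p k :=
    (summable_nat_add_iff 1).1 (by simpa using h)
  rw [h'.tsum_eq_zero_add]
  simpa using h.hasSum

theorem mean_pos (hp : 2 < p) : 0 < ∑' k : ℕ, (k : ℝ) * innovMass p k := by
  rw [← (hasSum_mean hp).tsum_eq]
  refine (summable_mean hp).tsum_pos
    (fun k => mul_nonneg (by positivity) (innovMass_nonneg _)) 0 ?_
  rw [innovMass_succ]
  have := zeta_pos hp
  positivity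

theorem statMass_nonneg (j : ℕ) : 0 ≤ statMass p j :=
  mul_nonneg (one_div_nonneg.2 (tsum_nonneg fun _ =>
    mul_nonneg (by positivity) (innovMass_nonneg _))) (tsum_nonneg fun _ => innovMass_nonneg _)

/-- `statMass` is a probability distribution on `ℕ`. -/
theorem hasSum_statMass (hp : 2 < p) : HasSum (statMass p) 1 := by
  have hm := hasSum_mean hp
  have hs : ∀ n : ℕ, ∑ x : Finset.HasAntidiagonal.antidiagonal n, innovMass p (x.1.2 + x.1.1 + 1)
      = ((n : ℝ) + 1) * innovMass p (n + 1) := by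
    intro n
    rw [Finset.sum_coe_sort (Finset.HasAntidiagonal.antidiagonal n) (fun x => innovMass p (x.2 + x.1 + 1)),
      Finset.sum_congr rfl (g := fun _ => innovMass p (n + 1))]
    · simp
    · intro x hx
      rw [← Finset.HasAntidiagonal.mem_antidiagonal.1 hx, add_comm x.2]
  have hsig : Summable fun x : (Σ n : ℕ, Finset.HasAntidiagonal.antidiagonal n) =>
      innovMass p (x.2.1.2 + x.2.1.1 + 1) := by
    rw [summable_sigma_of_nonneg fun _ => innovMass_nonneg _]
    refine ⟨fun n => Summable.of_finite, ?_⟩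
    simp only [tsum_fintype, hs]
    exact hm.summable
  have hprod : Summable fun x : ℕ × ℕ => innovMass p (x.2 + x.1 + 1) :=
    Finset.HasAntidiagonal.sigmaAntidiagonalEquivProd.summable_iff.1 hsig
  have htot : ∑' x : ℕ × ℕ, innovMass p (x.2 + x.1 + 1)
      = ∑' k : ℕ, (k : ℝ) * innovMass p k := by
    rw [← Finset.HasAntidiagonal.sigmaAntidiagonalEquivProd.tsum_eq, ← hm.tsum_eq]
    refine (Summable.tsum_sigma' (fun n => Summable.of_finite) hsig).trans ?_
    simp only [tsum_fintype]
    exact tsum_congr hs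
  have h := hprod.prod.hasSum
  rw [← hprod.tsum_prod, htot] at h
  have h2 := h.mul_left (1 / ∑' k : ℕ, (k : ℝ) * innovMass p k)
  rwa [one_div_mul_cancel (mean_pos hp).ne'] at h2

/-- `statMass` is invariant under the transition probabilities of the chain. -/
theorem statMass_invariant (hp : 2 < p) (j : ℕ) :
    HasSum (fun i : ℕ => statMass p i * transProb p i j) (statMass p j) := by
  have h0 : statMass p 0 = 1 / ∑' k : ℕ, (k : ℝ) * innovMass p k := by
    simp [statMass, (hasSum_innovMass hp).tsum_eq]
  have hsm : Summable fun i : ℕ => innovMass p (i + j + 1) := by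
    simpa [add_assoc, add_comm, add_left_comm] using
      (summable_nat_add_iff j).2 (hasSum_innovMass hp).summable
  have hrec : statMass p j = statMass p 0 * innovMass p (j + 1) + statMass p (j + 1) := by
    rw [h0, statMass, statMass, hsm.tsum_eq_zero_add, mul_add]
    simp [add_comm, add_left_comm]
  rw [hrec]
  have h := hasSum_sum_of_ne_finset_zero (L := SummationFilter.unconditional ℕ) (s := {0, j + 1})
    (f := fun i : ℕ => statMass p i * transProb p i j) (by
      intro i hi
      simp only [Finset.mem_insert, Finset.mem_singleton, not_or] at hi
      simp [transProb, hi.1, hi.2])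
  rw [Finset.sum_pair (by omega)] at h
  simpa [transProb] using h

end Checks

end DiscreteChain

/-!
The chain `W` counts down to `0` and, from `0`, jumps to `ε - 1`: its visits to `0` are renewal
times with gaps distributed as `ε`, and `P(ε > n)` is of order `n^{-p}`, while the stationary tail
`ν [n, ∞)` is of order `n^{-(p-1)}`.

**Meeting time.** `P(T^* ≥ n)` is of exact order `n^{-(p-1)}`, so that the two series behave like
`∑ 1 / n` and `∑ 1 / (n (log n)^{1+ε})`.
For the lower bound (`exists_le_meetTime_tail`), `W₀ ≥ 2 n` has probability of order `n^{-(p-1)}`,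
and then with probability at least `1 / 2` the independent second chain stays below `n` up to time
`n`, while `W_k = W₀ - k > n`.
For the upper bound (`exists_meetTime_tail_le`), with `p - 1 < q < p` the function
`(t + 2 max(a, b) + B)^q` of the time `t` and of the states `a ≠ b` of the two chains does not
increase in mean before the meeting time (`exists_drift`, `exists_lyapunov_drift`). Indeed
`max(a, b)` decreases by `1` unless one chain is at `0` and the other one at some `m`; then the next
innovation overshoots `m` by a small amount in mean if `m` is large, and makes the two chains meet
with probability `p_m`, bounded from below, if `m` is small. Hence
`n^q P(T^* > n, W₀ ∨ W₀^* < n) ≤ C E[(1 + W₀)^q; W₀ < n] ≤ C' n^{q - p + 1}`.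

**Gaussian approximation.** Let `ℓ_n = ⌈(n log n)^{1/p}⌉`. If `W_n = 0` and the innovation used at
time `n` exceeds `ℓ_n`, then `W` does not visit `0` during the next `ℓ_n` steps, so the centred
occupation sum moves by `-ν₀ ℓ_n`. The Gaussian sum has variance at most `C ℓ_n` over such a window,
whatever the joint law, so by Borel-Cantelli it moves by less than `ν₀ ℓ_n / 2` for all large `n`
(`ae_eventually_increment_lt`). Thus at one end of each such window the difference is at least
`ν₀ ℓ_n / 4` (`limsup_pos_of_frequently`). Such windows occur infinitely often
(`ae_frequently_large_jump`) by Lévy's extension of the Borel-Cantelli lemma, provided that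
`∑ a_k 1{W_k = 0} = ∞` with `a_k` of order `1 / (k log k)`. This last fact
(`ae_tendsto_weighted_visits`) follows from `W_{k+1} - W_k = -1 + ε_{k+1} 1{W_k = 0}`: summation by
parts gives `∑_{k<n} a_k ε_{k+1} 1{W_k = 0} ≥ ∑_{k<n} a_k - a_0 W_0`, and replacing `ε_{k+1}` by its
mean costs only a martingale bounded in `L²`.
-/

open MeasureTheory ProbabilityTheory Filter Topology
open scoped ENNReal

namespace DiscreteChain

variable {p : ℝ}

/-! ### Sums of powers and of logarithmic weights -/

/-- The discrete form of `s x^{-(s+1)} = -(x^{-s})'`, by which sums of powers telescope. -/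
theorem rpow_neg_succ_le_sub {s x : ℝ} (hs : 1 ≤ s) (hx : 0 < x) :
    (x + 1) ^ (-(s + 1)) ≤ x ^ (-s) - (x + 1) ^ (-s) := by
  have h1 : (x + 1) ^ (-(s + 1)) = (x + 1) ^ (-s) * (x + 1)⁻¹ := by
    rw [neg_add, Real.rpow_add (by positivity), Real.rpow_neg_one]
  have h2 : x ^ (-s) = (x + 1) ^ (-s) * ((x + 1) / x) ^ s := by
    rw [Real.div_rpow (by positivity) hx.le, Real.rpow_neg hx.le, Real.rpow_neg (by positivity)]
    have : (x + 1) ^ s ≠ 0 := by positivity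
    field_simp
  have h3 : 1 + (x + 1)⁻¹ ≤ ((x + 1) / x) ^ s := by
    have h4 : (x + 1) / x ≤ ((x + 1) / x) ^ s :=
      Real.self_le_rpow_of_one_le (by rw [le_div_iff₀ hx]; linarith) hs
    refine le_trans ?_ h4
    rw [add_div, div_self hx.ne', one_div]
    gcongr
    linarith
  have h5 : 0 ≤ (x + 1) ^ (-s) := by positivity
  rw [h1, h2]
  nlinarith

theorem summable_add_rpow_neg {s x : ℝ} (hs : 1 ≤ s) (hx : 0 < x) :
    Summable fun i : ℕ => (x + i) ^ (-(s + 1)) := by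
  refine (summable_nat_add_iff 1).1
    (summable_of_sum_range_le (c := x ^ (-s)) (fun i => by positivity) fun n => ?_)
  have h : ∀ n : ℕ, ∑ i ∈ Finset.range n, (x + ((i + 1 : ℕ) : ℝ)) ^ (-(s + 1))
      ≤ x ^ (-s) - (x + n) ^ (-s) := by
    intro n
    induction n with
    | zero => simp
    | succ n ih =>
      rw [Finset.sum_range_succ]
      have := rpow_neg_succ_le_sub hs (show 0 < x + n by positivity)
      push_cast at ih ⊢
      rw [← add_assoc]
      linarith
  have : 0 ≤ (x + n) ^ (-s) := by positivity
  linarith [h n]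

theorem tsum_add_rpow_neg_le {s x : ℝ} (hs : 1 ≤ s) (hx : 1 ≤ x) :
    ∑' i : ℕ, (x + i) ^ (-(s + 1)) ≤ 2 * x ^ (-s) := by
  have hx0 : 0 < x := by linarith
  refine Real.tsum_le_of_sum_range_le (fun i => by positivity) fun n => ?_
  have h : ∀ n : ℕ, ∑ i ∈ Finset.range (n + 1), (x + i) ^ (-(s + 1))
      ≤ x ^ (-(s + 1)) + x ^ (-s) - (x + n) ^ (-s) := by
    intro n
    induction n with
    | zero => simp
    | succ n ih =>
      rw [Finset.sum_range_succ]
      have := rpow_neg_succ_le_sub hs (show 0 < x + n by positivity)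
      push_cast
      rw [← add_assoc]
      linarith
  have h1 : x ^ (-(s + 1)) ≤ x ^ (-s) := Real.rpow_le_rpow_of_exponent_le hx (by linarith)
  have h2 : 0 ≤ (x + n) ^ (-s) := by positivity
  have h3 := h n
  rw [Finset.sum_range_succ] at h3
  have h4 : 0 ≤ (x + n) ^ (-(s + 1)) := by positivity
  linarith

theorem le_tsum_add_rpow_neg {s : ℝ} (hs : 1 ≤ s) (m : ℕ) :
    2 ^ (-(s + 1)) * ((m : ℝ) + 1) ^ (-s) ≤ ∑' i : ℕ, ((m : ℝ) + 1 + i) ^ (-(s + 1)) := by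
  have hm : (0 : ℝ) < (m : ℝ) + 1 := by positivity
  refine le_trans ?_ ((summable_add_rpow_neg hs hm).sum_le_tsum (Finset.range (m + 1))
    fun i _ => by positivity)
  have h : ∀ i ∈ Finset.range (m + 1),
      (2 * ((m : ℝ) + 1)) ^ (-(s + 1)) ≤ ((m : ℝ) + 1 + i) ^ (-(s + 1)) := by
    intro i hi
    have : (i : ℝ) ≤ m := by exact_mod_cast Nat.lt_succ_iff.1 (Finset.mem_range.1 hi)
    exact Real.rpow_le_rpow_of_nonpos (by positivity) (by linarith) (by linarith)
  refine le_trans (le_of_eq ?_) (Finset.card_nsmul_le_sum _ _ _ h)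
  rw [Finset.card_range, nsmul_eq_mul, Real.mul_rpow (by norm_num) hm.le,
    show -s = -(s + 1) + 1 by ring, Real.rpow_add_one hm.ne']
  push_cast
  ring

theorem sum_range_inv_sqrt_le (n : ℕ) :
    ∑ j ∈ Finset.range n, ((j : ℝ) + 1) ^ (-(1 / 2) : ℝ) ≤ 2 * (n : ℝ) ^ (1 / 2 : ℝ) := by
  induction n with
  | zero => simp
  | succ n ih =>
    rw [Finset.sum_range_succ]
    have h1 : (0 : ℝ) ≤ n := by positivity
    have h2 : ((n : ℝ) + 1) ^ (-(1 / 2) : ℝ) = (√((n : ℝ) + 1))⁻¹ := by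
      rw [Real.rpow_neg (by positivity), Real.sqrt_eq_rpow]
    rw [← Real.sqrt_eq_rpow] at ih ⊢
    rw [h2]
    push_cast
    have h3 : 0 < √((n : ℝ) + 1) := by positivity
    have h4 : √((n : ℝ) + 1) ^ 2 = n + 1 := Real.sq_sqrt (by positivity)
    have h5 : √(n : ℝ) ^ 2 = n := Real.sq_sqrt (by positivity)
    have h6 : (√((n : ℝ) + 1))⁻¹ ≤ 2 * (√((n : ℝ) + 1) - √n) := by
      rw [inv_le_iff_one_le_mul₀ h3]
      nlinarith [sq_nonneg (√((n : ℝ) + 1) - √n)]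
    linarith

/-- Bertrand's series at the critical exponent, shifted so that all terms are positive. -/
theorem not_summable_inv_mul_log :
    ¬ Summable fun n : ℕ => (((n : ℝ) + 3) * Real.log ((n : ℝ) + 3))⁻¹ := by
  intro h
  have hl : ∀ n : ℕ, 0 < Real.log ((n : ℝ) + 3) := fun n =>
    Real.log_pos (by linarith [n.cast_nonneg (α := ℝ)])
  rw [← summable_condensed_iff_of_nonneg] at h
  · have h3 : Summable fun k : ℕ => (4 * (2 + (k : ℝ)))⁻¹ := by
      refine Summable.of_nonneg_of_le (fun k => by positivity) (fun k => ?_) h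
      have h2k : (1 : ℝ) ≤ 2 ^ k := one_le_pow₀ (by norm_num)
      have hb : Real.log ((2 : ℝ) ^ k + 3) ≤ 2 + k := by
        calc Real.log ((2 : ℝ) ^ k + 3) ≤ Real.log (2 ^ (k + 2)) := by
              apply Real.log_le_log (by positivity); rw [pow_add]; linarith
          _ = (k + 2 : ℕ) * Real.log 2 := Real.log_pow _ _
          _ ≤ (k + 2 : ℕ) * 1 := by
              gcongr; linarith [Real.log_two_lt_d9]
          _ = 2 + k := by push_cast; ring
      have hl' := hl (2 ^ k)
      push_cast at hl' ⊢
      rw [mul_inv, mul_inv]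
      rw [← mul_assoc]
      gcongr
      rw [← div_eq_mul_inv, le_div_iff₀ (by positivity)]
      linarith
    have h4 : Summable fun k : ℕ => (((k + 2 : ℕ) : ℝ))⁻¹ := by
      refine (h3.mul_left 4).congr fun k => ?_
      push_cast
      rw [mul_inv, ← mul_assoc]
      norm_num [add_comm]
    exact Real.not_summable_natCast_inv
      ((summable_nat_add_iff (f := fun k : ℕ => ((k : ℝ))⁻¹) 2).1 h4)
  · intro n
    have := hl n
    positivity
  · intro m n _ hmn
    have := hl m
    have h1 : (m : ℝ) ≤ n := by exact_mod_cast hmn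
    gcongr

/-- Bertrand's series above the critical exponent. -/
theorem summable_inv_mul_log_rpow {ε : ℝ} (hε : 0 < ε) :
    Summable fun n : ℕ => ((n : ℝ) + 2)⁻¹ * Real.log ((n : ℝ) + 2) ^ (-(1 + ε)) := by
  have hl : ∀ n : ℕ, 0 < Real.log ((n : ℝ) + 2) :=
    fun n => Real.log_pos (by linarith [n.cast_nonneg (α := ℝ)])
  rw [← summable_condensed_iff_of_nonneg]
  · have h0 : Summable fun k : ℕ => ((k : ℝ) ) ^ (-(1 + ε)) :=
      Real.summable_nat_rpow.2 (by linarith)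
    rw [← summable_nat_add_iff 1] at h0 ⊢
    refine Summable.of_nonneg_of_le (fun k => ?_) (fun k => ?_)
      (h0.mul_left (Real.log 2 ^ (-(1 + ε))))
    · have := hl (2 ^ (k + 1)); positivity
    · have hl2 : 0 < Real.log 2 := Real.log_pos (by norm_num)
      rw [← Real.mul_rpow hl2.le (by positivity)]
      have h1 : Real.log 2 * ((k + 1 : ℕ) : ℝ) ≤ Real.log (((2 ^ (k + 1) : ℕ) : ℝ) + 2) := by
        rw [mul_comm, ← Real.log_pow]
        apply Real.log_le_log (by positivity)
        push_cast; linarith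
      have h2 : Real.log (((2 ^ (k + 1) : ℕ) : ℝ) + 2) ^ (-(1 + ε))
          ≤ (Real.log 2 * ((k + 1 : ℕ) : ℝ)) ^ (-(1 + ε)) :=
        Real.rpow_le_rpow_of_nonpos (by positivity) h1 (by linarith)
      have h3 : (2 : ℝ) ^ (k + 1) * (((2 ^ (k + 1) : ℕ) : ℝ) + 2)⁻¹ ≤ 1 := by
        rw [← div_eq_mul_inv, div_le_one (by positivity)]; push_cast; linarith
      rw [← mul_assoc]
      have h4 : 0 ≤ Real.log (((2 ^ (k + 1) : ℕ) : ℝ) + 2) ^ (-(1 + ε)) := by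
        have := hl (2 ^ (k + 1)); positivity
      calc _ ≤ 1 * Real.log (((2 ^ (k + 1) : ℕ) : ℝ) + 2) ^ (-(1 + ε)) := by gcongr
        _ ≤ _ := by rw [one_mul]; exact h2
  · intro n
    have := hl n
    positivity
  · intro m n _ hmn
    have := hl m
    have h1 : (m : ℝ) ≤ n := by exact_mod_cast hmn
    have h2 : Real.log ((n : ℝ) + 2) ^ (-(1 + ε)) ≤ Real.log ((m : ℝ) + 2) ^ (-(1 + ε)) :=
      Real.rpow_le_rpow_of_nonpos this (Real.log_le_log (by positivity) (by linarith)) (by linarith)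
    have := hl n
    gcongr

/-! ### Tails of the innovation law and of the stationary law -/

theorem tsum_innovMass_tail (j : ℕ) : ∑' i : ℕ, innovMass p (i + j + 1) =
    (∑' j : ℕ, ((j : ℝ) + 1) ^ (-(p + 1)))⁻¹ * ∑' i : ℕ, ((j : ℝ) + 1 + i) ^ (-(p + 1)) := by
  rw [← tsum_mul_left]
  refine tsum_congr fun i => ?_
  rw [innovMass_succ]
  push_cast
  ring_nf

theorem exists_le_innovMass_tail (hp : 2 < p) : ∃ c : ℝ, 0 < c ∧ ∀ j : ℕ,
    c * ((j : ℝ) + 1) ^ (-p) ≤ ∑' i : ℕ, innovMass p (i + j + 1) := by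
  have hz := zeta_pos hp
  refine ⟨(∑' j : ℕ, ((j : ℝ) + 1) ^ (-(p + 1)))⁻¹ * 2 ^ (-(p + 1)), by positivity, fun j => ?_⟩
  rw [tsum_innovMass_tail, mul_assoc]
  gcongr
  exact le_tsum_add_rpow_neg (by linarith) j

theorem exists_innovMass_tail_le (hp : 2 < p) : ∃ C : ℝ, 0 < C ∧ ∀ j : ℕ,
    ∑' i : ℕ, innovMass p (i + j + 1) ≤ C * ((j : ℝ) + 1) ^ (-p) := by
  have hz := zeta_pos hp
  refine ⟨(∑' j : ℕ, ((j : ℝ) + 1) ^ (-(p + 1)))⁻¹ * 2, by positivity, fun j => ?_⟩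
  rw [tsum_innovMass_tail, mul_assoc]
  gcongr
  exact tsum_add_rpow_neg_le (by linarith) (by linarith [j.cast_nonneg (α := ℝ)])

theorem exists_le_statMass (hp : 2 < p) : ∃ c : ℝ, 0 < c ∧ ∀ j : ℕ,
    c * ((j : ℝ) + 1) ^ (-p) ≤ statMass p j := by
  obtain ⟨c, hc, h⟩ := exists_le_innovMass_tail hp
  have hm := mean_pos hp
  refine ⟨(1 / ∑' k : ℕ, (k : ℝ) * innovMass p k) * c, by positivity, fun j => ?_⟩
  rw [statMass, mul_assoc]
  gcongr
  exact h j

theorem exists_statMass_le (hp : 2 < p) : ∃ C : ℝ, 0 < C ∧ ∀ j : ℕ,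
    statMass p j ≤ C * ((j : ℝ) + 1) ^ (-p) := by
  obtain ⟨c, hc, h⟩ := exists_innovMass_tail_le hp
  have hm := mean_pos hp
  refine ⟨(1 / ∑' k : ℕ, (k : ℝ) * innovMass p k) * c, by positivity, fun j => ?_⟩
  rw [statMass, mul_assoc]
  gcongr
  exact h j

theorem exists_le_statMass_tail (hp : 2 < p) : ∃ c : ℝ, 0 < c ∧ ∀ n : ℕ,
    c * ((n : ℝ) + 1) ^ (-(p - 1)) ≤ ∑' i : ℕ, statMass p (i + n) := by
  obtain ⟨c, hc, h⟩ := exists_le_statMass hp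
  refine ⟨c * 2 ^ (-p), by positivity, fun n => ?_⟩
  have hs := summable_add_rpow_neg (s := p - 1) (by linarith) (show 0 < (n : ℝ) + 1 by positivity)
  have h2 := le_tsum_add_rpow_neg (s := p - 1) (by linarith) n
  rw [show p - 1 + 1 = p by ring] at h2 hs
  rw [mul_assoc]
  refine (mul_le_mul_of_nonneg_left h2 hc.le).trans ?_
  rw [← tsum_mul_left]
  refine (hs.mul_left c).tsum_le_tsum (fun i => ?_)
    ((summable_nat_add_iff n).2 (hasSum_statMass hp).summable)
  refine le_trans (le_of_eq ?_) (h (i + n))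
  push_cast
  ring_nf

theorem exists_statMass_tail_le (hp : 2 < p) : ∃ C : ℝ, 0 < C ∧ ∀ n : ℕ,
    ∑' i : ℕ, statMass p (i + n) ≤ C * ((n : ℝ) + 1) ^ (-(p - 1)) := by
  obtain ⟨c, hc, h⟩ := exists_statMass_le hp
  refine ⟨c * 2, by positivity, fun n => ?_⟩
  have hs := summable_add_rpow_neg (s := p - 1) (by linarith) (show 0 < (n : ℝ) + 1 by positivity)
  have h2 := tsum_add_rpow_neg_le (s := p - 1) (x := n + 1) (by linarith)
    (by linarith [n.cast_nonneg (α := ℝ)])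
  rw [show p - 1 + 1 = p by ring] at h2 hs
  rw [mul_assoc]
  refine le_trans ?_ (mul_le_mul_of_nonneg_left h2 hc.le)
  rw [← tsum_mul_left]
  refine ((summable_nat_add_iff n).2 (hasSum_statMass hp).summable).tsum_le_tsum (fun i => ?_)
    (hs.mul_left c)
  refine (h (i + n)).trans (le_of_eq ?_)
  push_cast
  ring_nf

/-- The innovation law has finite moments of every order `q < p`. -/
theorem summable_rpow_mul_innovMass {q : ℝ} (hq : q < p) :
    Summable fun e : ℕ => (e : ℝ) ^ q * innovMass p e := by
  refine (summable_nat_add_iff 1).1 ?_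
  have h := (summable_nat_add_iff 1).2 (Real.summable_nat_rpow.2 (by linarith : q - (p + 1) < -1))
  refine (h.mul_left (∑' j : ℕ, ((j : ℝ) + 1) ^ (-(p + 1)))⁻¹).congr fun k => ?_
  have hk : (0 : ℝ) < (k : ℝ) + 1 := by positivity
  rw [innovMass_succ, sub_eq_add_neg]
  push_cast
  rw [Real.rpow_add hk]
  ring

theorem innovMass_zero : innovMass p 0 = 0 := by simp [innovMass]

theorem innovMass_pos (hp : 2 < p) {m : ℕ} (hm : m ≠ 0) : 0 < innovMass p m := by
  obtain ⟨k, rfl⟩ := Nat.exists_eq_succ_of_ne_zero hm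
  rw [Nat.succ_eq_add_one, innovMass_succ]
  have := zeta_pos hp
  positivity

theorem hasSum_innovMass' (hp : 2 < p) : HasSum (innovMass p) 1 := by
  rw [← hasSum_nat_add_iff' 1]
  simpa [innovMass_zero] using hasSum_innovMass hp

theorem innovMass_anti (hp : 2 < p) {m n : ℕ} (hm : m ≠ 0) (hmn : m ≤ n) :
    innovMass p n ≤ innovMass p m := by
  obtain ⟨k, rfl⟩ := Nat.exists_eq_succ_of_ne_zero hm
  obtain ⟨l, rfl⟩ := Nat.exists_eq_succ_of_ne_zero (show n ≠ 0 by omega)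
  rw [Nat.succ_eq_add_one, Nat.succ_eq_add_one, innovMass_succ, innovMass_succ]
  have := zeta_pos hp
  have h1 : (k : ℝ) ≤ l := by exact_mod_cast Nat.succ_le_succ_iff.1 hmn
  gcongr ?_ * ?_
  exact Real.rpow_le_rpow_of_nonpos (by positivity) (by linarith) (by linarith)

/-! ### The drift inequality for two chains at distance `m` -/

/-- Bernoulli's inequality at `x / (x + y)`, combined with `x + y ≤ x (1 + y)`. -/
theorem add_rpow_le_rpow_add {q x y : ℝ} (hq : 1 ≤ q) (hx : 1 ≤ x) (hy : 0 ≤ y) :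
    (x + y) ^ q ≤ x ^ q + q * x ^ (q - 1) * (y * (1 + y) ^ (q - 1)) := by
  have hx0 : 0 < x := by linarith
  have hxy : 0 < x + y := by linarith
  have hb := one_add_mul_self_le_rpow_one_add
    (s := -(y / (x + y))) (by rw [neg_le_neg_iff, div_le_one hxy]; linarith) hq
  have h1 : 1 + -(y / (x + y)) = x / (x + y) := by field_simp; ring
  rw [h1, Real.div_rpow hx0.le hxy.le, le_div_iff₀ (by positivity)] at hb
  have h2 : (x + y) ^ q = (x + y) ^ (q - 1) * (x + y) := by
    rw [← Real.rpow_add_one hxy.ne']; ring_nf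
  have h3 : q * -(y / (x + y)) * (x + y) ^ q = - (q * y * (x + y) ^ (q - 1)) := by
    rw [h2]; field_simp
  have h4 : (x + y) ^ (q - 1) ≤ x ^ (q - 1) * (1 + y) ^ (q - 1) := by
    rw [← Real.mul_rpow hx0.le (by positivity)]
    exact Real.rpow_le_rpow hxy.le (by nlinarith) (by linarith)
  have h5 : q * y * (x + y) ^ (q - 1) ≤ q * y * (x ^ (q - 1) * (1 + y) ^ (q - 1)) := by gcongr
  rw [add_mul, one_mul, h3] at hb
  linarith

theorem rpow_add_mul_rpow_le {q x : ℝ} (hq : 1 ≤ q) (hx : 0 < x) :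
    x ^ q + q * x ^ (q - 1) ≤ (x + 1) ^ q := by
  have hb := one_add_mul_self_le_rpow_one_add
    (s := x⁻¹) (by have : 0 < x⁻¹ := by positivity
                   linarith) hq
  have h1 : 1 + x⁻¹ = (x + 1) / x := by field_simp
  rw [h1, Real.div_rpow (by positivity) hx.le, le_div_iff₀ (by positivity)] at hb
  have h2 : x ^ q = x ^ (q - 1) * x := by rw [← Real.rpow_add_one hx.ne']; ring_nf
  have h3 : (1 + q * x⁻¹) * x ^ q = x ^ q + q * x ^ (q - 1) := by
    rw [add_mul, one_mul]; congr 1; rw [h2]; field_simp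
  linarith

/-- The cost `y (1 + y)^{q-1}` of the overshoot `y = 2 (e - m)⁺` of an innovation `e` over the
distance `m`. -/
noncomputable def overshootCost (q : ℝ) (m e : ℕ) : ℝ :=
  (2 * ((e - m : ℕ) : ℝ)) * (1 + 2 * ((e - m : ℕ) : ℝ)) ^ (q - 1)

theorem overshootCost_nonneg (q : ℝ) (m e : ℕ) : 0 ≤ overshootCost q m e := by
  unfold overshootCost; positivity

theorem overshootCost_mul_le {q : ℝ} (hq : 1 ≤ q) (m e : ℕ) :
    overshootCost q m e * innovMass p e ≤ 3 ^ q * ((e : ℝ) ^ q * innovMass p e) := by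
  rcases Nat.eq_zero_or_pos e with rfl | he
  · simp [innovMass_zero]
  rw [← mul_assoc]
  refine mul_le_mul_of_nonneg_right ?_ (innovMass_nonneg e)
  have he1 : (1 : ℝ) ≤ e := by exact_mod_cast he
  have h1 : ((e - m : ℕ) : ℝ) ≤ e := by exact_mod_cast Nat.sub_le e m
  have h2 : (0 : ℝ) ≤ ((e - m : ℕ) : ℝ) := by positivity
  rw [overshootCost, ← Real.mul_rpow (by norm_num) (by positivity)]
  calc _ ≤ (1 + 2 * ((e - m : ℕ) : ℝ)) * (1 + 2 * ((e - m : ℕ) : ℝ)) ^ (q - 1) := by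
        gcongr; linarith
    _ = (1 + 2 * ((e - m : ℕ) : ℝ)) ^ q := by
        rw [mul_comm, ← Real.rpow_add_one (by positivity)]; ring_nf
    _ ≤ _ := Real.rpow_le_rpow (by positivity) (by linarith) (by linarith)

theorem summable_overshootCost {q : ℝ} (hq1 : 1 ≤ q) (hq : q < p) (m : ℕ) :
    Summable fun e : ℕ => overshootCost q m e * innovMass p e :=
  Summable.of_nonneg_of_le (fun e => mul_nonneg (overshootCost_nonneg _ _ _) (innovMass_nonneg e))
    (overshootCost_mul_le hq1 m) ((summable_rpow_mul_innovMass hq).mul_left _)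

theorem tendsto_tsum_overshootCost {q : ℝ} (hq1 : 1 ≤ q) (hq : q < p) :
    Tendsto (fun m : ℕ => ∑' e : ℕ, overshootCost q m e * innovMass p e) atTop (𝓝 0) := by
  have h := tendsto_tsum_of_dominated_convergence (𝓕 := atTop)
    (f := fun m e : ℕ => overshootCost q m e * innovMass p e) (g := fun _ => (0 : ℝ))
    ((summable_rpow_mul_innovMass hq).mul_left (3 ^ q)) (fun e => ?_)
    (Eventually.of_forall fun m e => ?_)
  · simpa using h
  · refine tendsto_const_nhds.congr' ?_
    filter_upwards [eventually_ge_atTop e] with m hm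
    simp [overshootCost, Nat.sub_eq_zero_of_le hm]
  · rw [Real.norm_of_nonneg (mul_nonneg (overshootCost_nonneg _ _ _) (innovMass_nonneg e))]
    exact overshootCost_mul_le hq1 m e

/-- One chain is at `0`, the other one at `m`, and `x` stands for (elapsed time) `+ 2 m + B`. After
one step this quantity becomes `x - 1 + 2 (e - m)⁺`, unless `e = m`, when the chains meet. For large
`m` the decrease by `1` beats the mean overshoot; for the finitely many small `m` the chance
`p_m` of meeting does, as soon as `B` is large. -/
theorem exists_drift (hp : 2 < p) {q : ℝ} (hq1 : 1 ≤ q) (hq : q < p) :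
    ∃ B : ℝ, 1 ≤ B ∧ ∀ (m : ℕ) (x : ℝ), m ≠ 0 → B + 2 * m ≤ x →
      Summable (fun e : ℕ => (if e = m then 0 else (x - 1 + 2 * ((e - m : ℕ) : ℝ)) ^ q)
        * innovMass p e) ∧
      ∑' e : ℕ, (if e = m then 0 else (x - 1 + 2 * ((e - m : ℕ) : ℝ)) ^ q)
        * innovMass p e ≤ x ^ q := by
  set R : ℕ → ℝ := fun m => ∑' e : ℕ, overshootCost q m e * innovMass p e with hR
  have hRnn : ∀ m, 0 ≤ R m := fun m =>
    tsum_nonneg fun e => mul_nonneg (overshootCost_nonneg _ _ _) (innovMass_nonneg e)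
  obtain ⟨K, hK⟩ := eventually_atTop.1
    ((tendsto_tsum_overshootCost hq1 hq).eventually_le_const zero_lt_one)
  obtain ⟨C, hC⟩ := (tendsto_tsum_overshootCost hq1 hq).bddAbove_range
  have hRC : ∀ m, R m ≤ C := fun m => hC ⟨m, rfl⟩
  have hC0 : 0 ≤ C := (hRnn 0).trans (hRC 0)
  have hpK := innovMass_pos hp (Nat.succ_ne_zero K)
  have hB0 : 0 ≤ q * C / innovMass p (K + 1) := by positivity
  -- for `m ≤ K` this choice gives `(x - 1) p_m ≥ q C`, which pays for the overshoot
  refine ⟨1 + q * C / innovMass p (K + 1), by linarith, fun m x hm hx => ?_⟩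
  have hm1 : (1 : ℝ) ≤ m := by exact_mod_cast Nat.one_le_iff_ne_zero.2 hm
  have hx1 : 1 ≤ x - 1 := by linarith
  have hx0 : 0 < x - 1 := by linarith
  -- the term with `e = m` has no overshoot, so its removal saves exactly `(x - 1)^q p_m`
  set a : ℕ → ℝ := fun e => (x - 1) ^ q * innovMass p e
    + q * (x - 1) ^ (q - 1) * (overshootCost q m e * innovMass p e)
    - (if e = m then (x - 1) ^ q * innovMass p m else 0) with ha
  have hsum : HasSum a ((x - 1) ^ q * 1 + q * (x - 1) ^ (q - 1) * R m
      - (x - 1) ^ q * innovMass p m) := by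
    refine (((hasSum_innovMass' hp).mul_left _).add
      ((summable_overshootCost hq1 hq m).hasSum.mul_left _)).sub ?_
    exact hasSum_ite_eq m _
  have hle : ∀ e : ℕ, (if e = m then 0 else (x - 1 + 2 * ((e - m : ℕ) : ℝ)) ^ q)
      * innovMass p e ≤ a e := by
    intro e
    simp only [ha]
    split_ifs with h
    · subst h
      simp [overshootCost]
    · rw [sub_zero, ← mul_assoc, ← add_mul]
      exact mul_le_mul_of_nonneg_right
        (add_rpow_le_rpow_add hq1 hx1 (by positivity)) (innovMass_nonneg e)
  have hnn : ∀ e : ℕ, 0 ≤ (if e = m then 0 else (x - 1 + 2 * ((e - m : ℕ) : ℝ)) ^ q)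
      * innovMass p e := fun e =>
    mul_nonneg (by split_ifs <;> positivity) (innovMass_nonneg e)
  have hs := Summable.of_nonneg_of_le hnn hle hsum.summable
  refine ⟨hs, (hs.tsum_le_tsum hle hsum.summable).trans ?_⟩
  rw [hsum.tsum_eq]
  have hgrow := rpow_add_mul_rpow_le hq1 hx0
  rw [sub_add_cancel] at hgrow
  have hpos : 0 ≤ (x - 1) ^ (q - 1) := by positivity
  have hpos' : 0 ≤ q * (x - 1) ^ (q - 1) := by positivity
  have hpm : 0 ≤ (x - 1) ^ q * innovMass p m := mul_nonneg (by positivity) (innovMass_nonneg m)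
  rcases le_total K m with hKm | hmK
  · have := mul_le_mul_of_nonneg_left (hK m hKm) hpos'
    simp only [hR]
    linarith
  · have h1 : innovMass p (K + 1) ≤ innovMass p m := innovMass_anti hp hm (by omega)
    have h2 : q * C ≤ (x - 1) * innovMass p m := by
      have h3 : q * C / innovMass p (K + 1) ≤ x - 1 := by linarith
      rw [div_le_iff₀ hpK] at h3
      exact h3.trans (by gcongr)
    have h4 : (x - 1) ^ q = (x - 1) ^ (q - 1) * (x - 1) := by
      rw [← Real.rpow_add_one hx0.ne']; ring_nf
    have h5 : q * (x - 1) ^ (q - 1) * R m ≤ (x - 1) ^ q * innovMass p m := by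
      calc q * (x - 1) ^ (q - 1) * R m ≤ q * (x - 1) ^ (q - 1) * C := by gcongr; exact hRC m
        _ = (x - 1) ^ (q - 1) * (q * C) := by ring
        _ ≤ (x - 1) ^ (q - 1) * ((x - 1) * innovMass p m) := by gcongr
        _ = _ := by rw [h4]; ring
    have h6 : 0 ≤ q * (x - 1) ^ (q - 1) := by positivity
    linarith

/-! ### Independence of the past and the next innovation -/

section Past

variable {Ω : Type*} [MeasurableSpace Ω] {P : Measure Ω} [IsProbabilityMeasure P]

/-- If `X` is independent of `(Y, Z)` and `Y` is independent of `Z`, then `(X, Y)` is independent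
of `Z`. -/
theorem indepFun_prodMk_left {α β γ : Type*} [MeasurableSpace α] [MeasurableSpace β]
    [MeasurableSpace γ] {X : Ω → α} {Y : Ω → β} {Z : Ω → γ} (hX : Measurable X)
    (hY : Measurable Y) (hZ : Measurable Z) (h : IndepFun X (fun ω => (Y ω, Z ω)) P)
    (h' : IndepFun Y Z P) : IndepFun (fun ω => (X ω, Y ω)) Z P := by
  have hYZ := (indepFun_iff_map_prod_eq_prod_map_map hY.aemeasurable hZ.aemeasurable).1 h'
  have hXYZ := (indepFun_iff_map_prod_eq_prod_map_map hX.aemeasurable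
    (hY.prodMk hZ).aemeasurable).1 h
  have hXY := (indepFun_iff_map_prod_eq_prod_map_map hX.aemeasurable hY.aemeasurable).1
    (h.comp measurable_id measurable_fst)
  have : IsProbabilityMeasure (P.map X) := Measure.isProbabilityMeasure_map hX.aemeasurable
  have : IsProbabilityMeasure (P.map Y) := Measure.isProbabilityMeasure_map hY.aemeasurable
  have : IsProbabilityMeasure (P.map Z) := Measure.isProbabilityMeasure_map hZ.aemeasurable
  rw [indepFun_iff_map_prod_eq_prod_map_map (hX.prodMk hY).aemeasurable hZ.aemeasurable, hXY]
  have h1 : P.map (fun ω => ((X ω, Y ω), Z ω)) =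
      (P.map fun ω => (X ω, (Y ω, Z ω))).map MeasurableEquiv.prodAssoc.symm := by
    rw [Measure.map_map MeasurableEquiv.prodAssoc.symm.measurable (hX.prodMk (hY.prodMk hZ))]
    rfl
  rw [h1, hXYZ, hYZ, ← Measure.prodAssoc_prod, Measure.map_map
    MeasurableEquiv.prodAssoc.symm.measurable MeasurableEquiv.prodAssoc.measurable]
  simp

/-- The σ-algebras generated by `X` and `ξ 0, …, ξ (n - 1)`. -/
def past {E : Type*} [MeasurableSpace E] (X : Ω → E) (hX : Measurable X) (ξ : ℕ → Ω → ℕ)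
    (hξ : ∀ i, Measurable (ξ i)) : Filtration ℕ ‹MeasurableSpace Ω› where
  seq n := MeasurableSpace.comap (fun ω => (X ω, fun i : Finset.range n => ξ i ω)) inferInstance
  mono' m n hmn := by
    let π : E × (Finset.range n → ℕ) → E × (Finset.range m → ℕ) :=
      fun z => (z.1, fun i => z.2 ⟨i, Finset.range_subset_range.2 hmn i.2⟩)
    have hπ : Measurable π := by
      refine measurable_fst.prodMk (measurable_pi_lambda _ fun i => ?_)
      exact (measurable_pi_apply _).comp measurable_snd
    refine Measurable.comap_le ?_
    exact hπ.comp (comap_measurable fun ω => (X ω, fun i : Finset.range n => ξ i ω))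
  le' n := (hX.prodMk (measurable_pi_lambda (fun ω (i : Finset.range n) => ξ i ω)
    fun i => hξ i)).comap_le

variable {E : Type*} [MeasurableSpace E] {X : Ω → E} {hX : Measurable X} {ξ : ℕ → Ω → ℕ}
  {hξ : ∀ i, Measurable (ξ i)}

theorem measurable_past_init (n : ℕ) : Measurable[past X hX ξ hξ n] X :=
  measurable_fst.comp (comap_measurable fun ω => (X ω, fun i : Finset.range n => ξ i ω))

theorem measurable_past_innov {i n : ℕ} (hi : i < n) : Measurable[past X hX ξ hξ n] (ξ i) :=
  ((measurable_pi_apply (⟨i, Finset.mem_range.2 hi⟩ : Finset.range n)).comp measurable_snd).comp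
    (comap_measurable fun ω => (X ω, fun i : Finset.range n => ξ i ω))

theorem indep_past (hind : iIndepFun ξ P) (hXξ : IndepFun X (fun ω i => ξ i ω) P) (n : ℕ) :
    Indep (past X hX ξ hξ n) (MeasurableSpace.comap (ξ n) inferInstance) P := by
  have hY : Measurable fun ω => fun i : Finset.range n => ξ i ω :=
    measurable_pi_lambda _ fun i => hξ i
  have h1 : IndepFun (fun ω => fun i : Finset.range n => ξ i ω) (ξ n) P :=
    (hind.indepFun_finset (Finset.range n) {n} (by simp) hξ).comp measurable_id
      (measurable_pi_apply (⟨n, by simp⟩ : ({n} : Finset ℕ)))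
  have h2 : IndepFun X (fun ω => ((fun i : Finset.range n => ξ i ω), ξ n ω)) P := by
    refine hXξ.comp (φ := id) (ψ := fun e : ℕ → ℕ => ((fun i : Finset.range n => e i), e n))
      measurable_id ?_
    fun_prop
  exact indepFun_prodMk_left hX hY (hξ n) h2 h1

/-- A random variable which is determined by the past at time `n` is independent of `ξ n`. -/
theorem indepFun_of_measurable_past (hind : iIndepFun ξ P)
    (hXξ : IndepFun X (fun ω i => ξ i ω) P) {n : ℕ} {β : Type*} [MeasurableSpace β] {Y : Ω → β}
    (hY : Measurable[past X hX ξ hξ n] Y) : IndepFun Y (ξ n) P :=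
  indep_of_indep_of_le_left (indep_past hind hXξ n) hY.comap_le

theorem measurable_step : Measurable fun z : ℕ × ℕ => step z.1 z.2 :=
  measurable_of_countable _

theorem measurable_past_chain {w : E → ℕ} (hw : Measurable w) (n : ℕ) :
    Measurable[past X hX ξ hξ n] fun ω => chain (fun i => ξ i ω) (w (X ω)) n := by
  induction n with
  | zero => exact hw.comp (measurable_past_init 0)
  | succ n ih =>
    have h1 := ih.mono ((past X hX ξ hξ).mono n.le_succ) le_rfl
    have h2 : Measurable[past X hX ξ hξ (n + 1)] (ξ n) := measurable_past_innov n.lt_succ_self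
    exact measurable_step.comp (h2.prodMk h1)

end Past

/-! ### Integer-valued random variables -/

section Law

variable {Ω : Type*} [MeasurableSpace Ω] {P : Measure Ω} [IsProbabilityMeasure P]

theorem measure_eq_ofReal {X : Ω → ℕ} {f : ℕ → ℝ} (hf : ∀ k, P.real {ω | X ω = k} = f k) (k : ℕ) :
    P {ω | X ω = k} = ENNReal.ofReal (f k) := by
  rw [← hf, ofReal_measureReal]

theorem lintegral_comp_nat {P : Measure Ω} {X : Ω → ℕ} (hX : Measurable X) (F : ℕ → ℝ≥0∞) :
    ∫⁻ ω, F (X ω) ∂P = ∑' k, F k * P {ω | X ω = k} := by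
  rw [← lintegral_map (f := F) (measurable_of_countable _) hX, lintegral_countable']
  refine tsum_congr fun k => ?_
  rw [Measure.map_apply hX (measurableSet_singleton k)]
  rfl

theorem hasSum_tail {X : Ω → ℕ} (hX : Measurable X) {f : ℕ → ℝ}
    (hf : ∀ k, P.real {ω | X ω = k} = f k) (n : ℕ) :
    HasSum (fun i => f (i + n)) (P.real {ω | n ≤ X ω}) := by
  have h1 : {ω | n ≤ X ω} = ⋃ i, {ω | X ω = i + n} := by
    ext ω
    simp only [Set.mem_ofPred_eq, Set.mem_iUnion]
    exact ⟨fun h => ⟨X ω - n, by omega⟩, fun ⟨i, hi⟩ => by omega⟩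
  have h2 : P {ω | n ≤ X ω} = ∑' i, P {ω | X ω = i + n} := by
    rw [h1]
    refine measure_iUnion (fun i j hij => ?_) fun i => hX (measurableSet_singleton (i + n))
    refine Set.disjoint_left.2 fun ω hi hj => hij ?_
    simp only [Set.mem_ofPred_eq] at hi hj
    omega
  have h3 : ∑' i, P {ω | X ω = i + n} ≠ ∞ := h2 ▸ measure_ne_top P _
  have h4 := ENNReal.hasSum_toReal h3
  rw [← ENNReal.tsum_toReal_eq fun _ => measure_ne_top P _, ← h2] at h4
  simpa [← hf, measureReal_def] using h4

theorem lintegral_indep_nat {β : Type*} [MeasurableSpace β] [Countable β]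
    [MeasurableSingletonClass β] {Y : Ω → β} {X : Ω → ℕ} (hY : Measurable Y) (hX : Measurable X)
    (h : IndepFun Y X P) (F : β → ℕ → ℝ≥0∞) :
    ∫⁻ ω, F (Y ω) (X ω) ∂P = ∫⁻ ω, ∑' e, F (Y ω) e * P {ω | X ω = e} ∂P := by
  have : IsProbabilityMeasure (P.map Y) := Measure.isProbabilityMeasure_map hY.aemeasurable
  have : IsProbabilityMeasure (P.map X) := Measure.isProbabilityMeasure_map hX.aemeasurable
  have hF : Measurable fun z : β × ℕ => F z.1 z.2 := measurable_of_countable _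
  calc ∫⁻ ω, F (Y ω) (X ω) ∂P = ∫⁻ z, F z.1 z.2 ∂(P.map fun ω => (Y ω, X ω)) :=
        (lintegral_map hF (hY.prodMk hX)).symm
    _ = ∫⁻ y, ∫⁻ x, F y x ∂(P.map X) ∂(P.map Y) := by
        rw [(indepFun_iff_map_prod_eq_prod_map_map hY.aemeasurable hX.aemeasurable).1 h,
          lintegral_prod _ hF.aemeasurable]
    _ = ∫⁻ ω, ∫⁻ x, F (Y ω) x ∂(P.map X) ∂P := lintegral_map (measurable_of_countable _) hY
    _ = _ := by
        refine lintegral_congr fun ω => ?_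
        rw [lintegral_map (measurable_of_countable _) hX, lintegral_comp_nat hX (F (Y ω))]

/-- The innovations take the value `0` with probability zero, since the weights `p_k`, `k ≥ 1`,
already add up to one. -/
theorem innov_law (hp : 2 < p) {X : Ω → ℕ} (hX : Measurable X)
    (h : ∀ k : ℕ, 1 ≤ k → P.real {ω | X ω = k} = innovMass p k) (k : ℕ) :
    P.real {ω | X ω = k} = innovMass p k := by
  rcases Nat.eq_zero_or_pos k with rfl | hk
  · have h0 := hasSum_tail hX (fun _ => rfl : ∀ k, P.real {ω | X ω = k} = P.real {ω | X ω = k}) 0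
    have h1 := h0.summable.tsum_eq_zero_add
    rw [h0.tsum_eq] at h1
    have h2 : ∑' b : ℕ, P.real {ω | X ω = b + 1 + 0} = 1 := by
      rw [← (hasSum_innovMass hp).tsum_eq]
      exact tsum_congr fun b => h (b + 1) (by omega)
    rw [h2] at h1
    simp only [Nat.zero_le, Set.ofPred_true, probReal_univ] at h1
    rw [innovMass_zero]
    simpa using h1
  · exact h k hk

end Law

/-! ### Tail of the meeting time -/

theorem lt_meetTime_iff (e : ℕ → ℕ) (w w' n : ℕ) :
    ((n + 1 : ℕ) : ℕ∞) ≤ meetTime e w w' ↔ ∀ k ≤ n, chain e w k ≠ chain e w' k := by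
  rw [meetTime, le_sInf_iff]
  constructor
  · intro h k hk heq
    have := h k ⟨k, rfl, heq⟩
    rw [Nat.cast_le] at this
    omega
  · rintro h _ ⟨k, rfl, heq⟩
    rw [Nat.cast_le]
    by_contra hc
    exact h k (by omega) heq

/-- The Lyapunov function `(t + 2 max(a, b) + B)^q` of two chains which are at `a` and `b` at
time `t`. -/
noncomputable def lyapunov (B q : ℝ) (t a b : ℕ) : ℝ≥0∞ :=
  ENNReal.ofReal (((t : ℝ) + 2 * ((max a b : ℕ) : ℝ) + B) ^ q)

/-- As long as the two chains have not met, the Lyapunov function does not increase in mean. -/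
theorem exists_lyapunov_drift (hp : 2 < p) {q : ℝ} (hq1 : 1 ≤ q) (hq : q < p) :
    ∃ B : ℝ, 1 ≤ B ∧ ∀ t a b : ℕ, a ≠ b →
      ∑' e : ℕ, (if step e a = step e b then 0 else lyapunov B q (t + 1) (step e a) (step e b))
        * ENNReal.ofReal (innovMass p e) ≤ lyapunov B q t a b := by
  obtain ⟨B, hB, hdrift⟩ := exists_drift hp hq1 hq
  refine ⟨B, hB, fun t a b hab => ?_⟩
  have ht : (0 : ℝ) ≤ t := by positivity
  by_cases h0 : a = 0 ∨ b = 0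
  · obtain ⟨hs, hle⟩ := hdrift (max a b) (t + 2 * ((max a b : ℕ) : ℝ) + B) (by omega) (by linarith)
    refine le_trans ?_ (ENNReal.ofReal_le_ofReal hle)
    rw [ENNReal.ofReal_tsum_of_nonneg (fun e => ?_) hs]
    · refine ENNReal.tsum_le_tsum fun e => ?_
      rcases Nat.eq_zero_or_pos e with rfl | he
      · simp [innovMass_zero]
      rw [ENNReal.ofReal_mul' (innovMass_nonneg e)]
      gcongr
      split_ifs with h1 h2 h2
      · simp
      · simp
      · exfalso
        refine h1 ?_
        rcases h0 with rfl | rfl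
        · simp [step, h2, Ne.symm hab]
        · simp [step, h2, hab]
      · have h3 : max (step e a) (step e b) + 1 = max a b + (e - max a b) := by
          rcases h0 with rfl | rfl
          · simp [step, Ne.symm hab]; omega
          · simp [step, hab]; omega
        have h4 : ((max (step e a) (step e b) : ℕ) : ℝ) + 1
            = ((max a b : ℕ) : ℝ) + ((e - max a b : ℕ) : ℝ) := by exact_mod_cast h3
        rw [lyapunov]
        refine le_of_eq (congrArg (fun z : ℝ => ENNReal.ofReal (z ^ q)) ?_)
        push_cast at h4 ⊢
        linarith
    · refine mul_nonneg ?_ (innovMass_nonneg e)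
      split_ifs
      · exact le_rfl
      · have h1 : (0 : ℝ) ≤ ((max a b : ℕ) : ℝ) := by positivity
        have h2 : (0 : ℝ) ≤ ((e - max a b : ℕ) : ℝ) := by positivity
        exact Real.rpow_nonneg (by linarith) _
  · obtain ⟨ha, hb⟩ := not_or.1 h0
    calc _ ≤ ∑' e : ℕ, lyapunov B q t a b * ENNReal.ofReal (innovMass p e) := by
          refine ENNReal.tsum_le_tsum fun e => ?_
          gcongr
          split_ifs
          · simp
          · have h3 : max (step e a) (step e b) + 1 = max a b := by
              simp [step, ha, hb]; omega
            have h4 : ((max (step e a) (step e b) : ℕ) : ℝ) + 1 = ((max a b : ℕ) : ℝ) := by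
              exact_mod_cast h3
            have h5 : (0 : ℝ) ≤ ((max (step e a) (step e b) : ℕ) : ℝ) := by positivity
            refine ENNReal.ofReal_le_ofReal (Real.rpow_le_rpow ?_ ?_ (by linarith))
            · push_cast at h5 ⊢; linarith
            · push_cast at h4 ⊢; linarith
      _ = lyapunov B q t a b := by
          rw [ENNReal.tsum_mul_left, ← ENNReal.ofReal_tsum_of_nonneg innovMass_nonneg
            (hasSum_innovMass' hp).summable, (hasSum_innovMass' hp).tsum_eq]
          simp

section Meeting

variable {Ω : Type*} [MeasurableSpace Ω] {P : Measure Ω} [IsProbabilityMeasure P]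
  {ξ : ℕ → Ω → ℕ} {W₀ W₀' : Ω → ℕ}

/-- A moment bound for the meeting time, on an event `(W₀, W₀') ∈ S`: the Lyapunov function, stopped
at the meeting, is a supermartingale, and it is at least `n^q` at time `n`. -/
theorem rpow_mul_measure_le {B q : ℝ} (hq : 0 ≤ q) (hB : 0 ≤ B)
    (hdrift : ∀ t a b : ℕ, a ≠ b →
      ∑' e : ℕ, (if step e a = step e b then 0 else lyapunov B q (t + 1) (step e a) (step e b))
        * ENNReal.ofReal (innovMass p e) ≤ lyapunov B q t a b)
    (hξ : ∀ i, Measurable (ξ i)) (hlaw : ∀ i k : ℕ, P.real {ω | ξ i ω = k} = innovMass p k)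
    (hind : iIndepFun ξ P) (hW : Measurable W₀) (hW' : Measurable W₀')
    (hWξ : IndepFun (fun ω => (W₀ ω, W₀' ω)) (fun ω i => ξ i ω) P) (S : Set (ℕ × ℕ))
    [DecidablePred (· ∈ S)] (n : ℕ) :
    ENNReal.ofReal ((n : ℝ) ^ q) * P {ω | (W₀ ω, W₀' ω) ∈ S ∧
      ∀ k ≤ n, chain (fun i => ξ i ω) (W₀ ω) k ≠ chain (fun i => ξ i ω) (W₀' ω) k}
    ≤ ∫⁻ ω, (if (W₀ ω, W₀' ω) ∈ S then lyapunov B q 0 (W₀ ω) (W₀' ω) else 0) ∂P := by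
  classical
  set Z : ℕ → Ω → ℕ := fun k ω => chain (fun i => ξ i ω) (W₀ ω) k with hZ
  set Z' : ℕ → Ω → ℕ := fun k ω => chain (fun i => ξ i ω) (W₀' ω) k with hZ'
  set D : ℕ → Set Ω := fun n => {ω | (W₀ ω, W₀' ω) ∈ S ∧ ∀ k ≤ n, Z k ω ≠ Z' k ω} with hD
  have hX : Measurable fun ω => (W₀ ω, W₀' ω) := hW.prodMk hW'
  have hZm : ∀ n, Measurable[past _ hX ξ hξ n] (Z n) := fun n =>
    measurable_past_chain (w := Prod.fst) (measurable_of_countable _) n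
  have hZm' : ∀ n, Measurable[past _ hX ξ hξ n] (Z' n) := fun n =>
    measurable_past_chain (w := Prod.snd) (measurable_of_countable _) n
  have hDm : ∀ n, MeasurableSet[past _ hX ξ hξ n] (D n) := by
    intro n
    have h1 : MeasurableSet[past _ hX ξ hξ n] {ω | (W₀ ω, W₀' ω) ∈ S} :=
      measurable_past_init n S.to_countable.measurableSet
    have h2 : MeasurableSet[past _ hX ξ hξ n] {ω | ∀ k ≤ n, Z k ω ≠ Z' k ω} := by
      have : {ω | ∀ k ≤ n, Z k ω ≠ Z' k ω} = ⋂ k : Fin (n + 1), {ω | Z k ω ≠ Z' k ω} := by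
        ext ω
        simp only [Set.mem_ofPred_eq, Set.mem_iInter]
        exact ⟨fun h k => h k (by omega), fun h k hk => h ⟨k, by omega⟩⟩
      rw [this]
      refine MeasurableSet.iInter fun k => ?_
      have hk : (k : ℕ) ≤ n := by omega
      have h3 := ((hZm k).mono ((past _ hX ξ hξ).mono hk) le_rfl).prodMk
        ((hZm' k).mono ((past _ hX ξ hξ).mono hk) le_rfl)
      exact h3 ({z : ℕ × ℕ | z.1 ≠ z.2}.to_countable.measurableSet)
    exact h1.inter h2
  have hstep : ∀ n, ∫⁻ ω, (if ω ∈ D (n + 1) then lyapunov B q (n + 1) (Z (n + 1) ω) (Z' (n + 1) ω)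
      else 0) ∂P ≤ ∫⁻ ω, (if ω ∈ D n then lyapunov B q n (Z n ω) (Z' n ω) else 0) ∂P := by
    intro n
    -- the state at time `n`, together with the event that the chains have not met
    let Y : Ω → (ℕ × ℕ) × Prop := fun ω => ((Z n ω, Z' n ω), ω ∈ D n)
    have hY : Measurable[past _ hX ξ hξ n] Y :=
      ((hZm n).prodMk (hZm' n)).prodMk 
        ((@measurableSet_setOfPred _ (past _ hX ξ hξ n) _).1 (hDm n))
    let F : (ℕ × ℕ) × Prop → ℕ → ℝ≥0∞ := fun y e => if y.2 then
      (if step e y.1.1 = step e y.1.2 then 0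
        else lyapunov B q (n + 1) (step e y.1.1) (step e y.1.2)) else 0
    have hDs : ∀ ω, ω ∈ D (n + 1) ↔ ω ∈ D n ∧ Z (n + 1) ω ≠ Z' (n + 1) ω := by
      intro ω
      simp only [hD, Set.mem_ofPred_eq, Nat.le_succ_iff]
      constructor
      · exact fun h => ⟨⟨h.1, fun k hk => h.2 k (Or.inl hk)⟩, h.2 _ (Or.inr rfl)⟩
      · rintro ⟨⟨h1, h2⟩, h3⟩
        refine ⟨h1, fun k hk => ?_⟩
        rcases hk with hk | rfl
        · exact h2 k hk
        · exact h3
    calc _ = ∫⁻ ω, F (Y ω) (ξ n ω) ∂P := by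
          refine lintegral_congr fun ω => ?_
          have h1 : step (ξ n ω) (Z n ω) = Z (n + 1) ω := rfl
          have h2 : step (ξ n ω) (Z' n ω) = Z' (n + 1) ω := rfl
          simp only [F, Y, h1, h2, hDs]
          by_cases h3 : ω ∈ D n <;> by_cases h4 : Z (n + 1) ω = Z' (n + 1) ω <;> simp [h3, h4]
      _ = ∫⁻ ω, ∑' e, F (Y ω) e * P {ω | ξ n ω = e} ∂P :=
          lintegral_indep_nat (hY.mono ((past _ hX ξ hξ).le n) le_rfl) (hξ n)
            (indepFun_of_measurable_past hind hWξ hY) F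
      _ ≤ _ := by
          refine lintegral_mono fun ω => ?_
          simp only [measure_eq_ofReal (hlaw n)]
          by_cases h3 : ω ∈ D n
          · simp only [F, Y, h3, if_true]
            exact hdrift n _ _ (h3.2 n le_rfl)
          · simp [F, Y, h3]
  have hall : ∀ n, ∫⁻ ω, (if ω ∈ D n then lyapunov B q n (Z n ω) (Z' n ω) else 0) ∂P ≤
      ∫⁻ ω, (if (W₀ ω, W₀' ω) ∈ S then lyapunov B q 0 (W₀ ω) (W₀' ω) else 0) ∂P := by
    intro n
    induction n with
    | zero =>
      refine lintegral_mono fun ω => ?_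
      by_cases h : (W₀ ω, W₀' ω) ∈ S
      · simp only [h, if_true]
        split_ifs
        · exact le_rfl
        · simp
      · simp [hD, h]
    | succ n ih => exact (hstep n).trans ih
  refine le_trans ?_ (hall n)
  have hDm0 := (past _ hX ξ hξ).le n _ (hDm n)
  rw [← lintegral_indicator_const hDm0]
  refine lintegral_mono fun ω => ?_
  by_cases h : ω ∈ D n
  · simp only [h, Set.indicator_of_mem, if_true]
    refine ENNReal.ofReal_le_ofReal (Real.rpow_le_rpow (by positivity) ?_ hq)
    have : (0 : ℝ) ≤ ((max (Z n ω) (Z' n ω) : ℕ) : ℝ) := by positivity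
    linarith
  · simp [h]

theorem indepFun_pair (hξ : ∀ i, Measurable (ξ i)) (hW : Measurable W₀) (hW' : Measurable W₀')
    (h : IndepFun W₀ (fun ω i => ξ i ω) P)
    (h' : IndepFun W₀' (fun ω => (W₀ ω, fun i => ξ i ω)) P) :
    IndepFun (fun ω => (W₀ ω, W₀' ω)) (fun ω i => ξ i ω) P :=
  (indepFun_prodMk_left hW' hW (measurable_pi_lambda _ hξ) h' h).comp measurable_swap measurable_id

/-- The stationary law has no moment of order `p - 1 / 2`, but the moment truncated at `n` is at most
of order `n^{1/2}`. -/
theorem lintegral_truncated_moment_le {C : ℝ}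
    (hC : ∀ j : ℕ, statMass p j ≤ C * ((j : ℝ) + 1) ^ (-p)) (hC0 : 0 ≤ C)
    (hW : Measurable W₀) (hl : ∀ j, P.real {ω | W₀ ω = j} = statMass p j) (n : ℕ) :
    ∫⁻ ω, (if W₀ ω < n then ENNReal.ofReal (((W₀ ω : ℝ) + 1) ^ (p - 1 / 2)) else 0) ∂P ≤
      ENNReal.ofReal (2 * C * (n : ℝ) ^ (1 / 2 : ℝ)) := by
  rw [lintegral_comp_nat hW
    (fun k => if k < n then ENNReal.ofReal (((k : ℝ) + 1) ^ (p - 1 / 2)) else 0),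
    tsum_eq_sum (s := Finset.range n) (fun k hk => by
      rw [Finset.mem_range] at hk; simp [hk])]
  have h1 : ∀ k ∈ Finset.range n,
      (if k < n then ENNReal.ofReal (((k : ℝ) + 1) ^ (p - 1 / 2)) else 0) * P {ω | W₀ ω = k} ≤
        ENNReal.ofReal (C * ((k : ℝ) + 1) ^ (-(1 / 2) : ℝ)) := by
    intro k hk
    have hk0 : (0 : ℝ) < (k : ℝ) + 1 := by positivity
    rw [if_pos (Finset.mem_range.1 hk), measure_eq_ofReal hl, ← ENNReal.ofReal_mul (by positivity)]
    refine ENNReal.ofReal_le_ofReal ?_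
    calc _ ≤ ((k : ℝ) + 1) ^ (p - 1 / 2) * (C * ((k : ℝ) + 1) ^ (-p)) := by gcongr; exact hC k
      _ = C * (((k : ℝ) + 1) ^ (p - 1 / 2) * ((k : ℝ) + 1) ^ (-p)) := by ring
      _ = _ := by rw [← Real.rpow_add hk0]; ring_nf
  refine (Finset.sum_le_sum h1).trans ?_
  rw [← ENNReal.ofReal_sum_of_nonneg (fun k _ => by positivity), ← Finset.mul_sum]
  refine ENNReal.ofReal_le_ofReal ?_
  calc _ ≤ C * (2 * (n : ℝ) ^ (1 / 2 : ℝ)) := by gcongr; exact sum_range_inv_sqrt_le n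
    _ = _ := by ring

/-- The meeting time of two independent stationary chains has tail of order at most `n^{-(p-1)}`. -/
theorem exists_meetTime_tail_le (hp : 2 < p) (hξ : ∀ i, Measurable (ξ i))
    (hlaw : ∀ i k : ℕ, P.real {ω | ξ i ω = k} = innovMass p k) (hind : iIndepFun ξ P)
    (hW : Measurable W₀) (hW' : Measurable W₀')
    (hl : ∀ j, P.real {ω | W₀ ω = j} = statMass p j)
    (hl' : ∀ j, P.real {ω | W₀' ω = j} = statMass p j)
    (hWξ : IndepFun W₀ (fun ω i => ξ i ω) P)
    (hWξ' : IndepFun W₀' (fun ω => (W₀ ω, fun i => ξ i ω)) P) :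
    ∃ C : ℝ, 0 < C ∧ ∀ n : ℕ, P {ω | ((n + 2 : ℕ) : ℕ∞) ≤ meetTime (fun i => ξ i ω) (W₀ ω) (W₀' ω)}
      ≤ ENNReal.ofReal (C * ((n : ℝ) + 1) ^ (-(p - 1))) := by
  -- any exponent strictly between `p - 1` and `p` would do
  obtain ⟨B, hB, hdrift⟩ := exists_lyapunov_drift hp (q := p - 1 / 2) (by linarith) (by linarith)
  obtain ⟨C₁, hC₁, h₁⟩ := exists_statMass_le hp
  obtain ⟨C₂, hC₂, h₂⟩ := exists_statMass_tail_le hp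
  refine ⟨(2 + B) ^ (p - 1 / 2) * (2 * (2 * C₁)) + 2 * C₂, by positivity, fun n => ?_⟩
  have hn0 : (0 : ℝ) < (n : ℝ) + 1 := by positivity
  have hmom := rpow_mul_measure_le (by linarith : 0 ≤ p - 1 / 2) (by linarith) hdrift hξ hlaw hind
    hW hW' (indepFun_pair hξ hW hW' hWξ hWξ') {z | z.1 < n + 1 ∧ z.2 < n + 1} (n + 1)
  set A : Set Ω := {ω | (W₀ ω, W₀' ω) ∈ {z : ℕ × ℕ | z.1 < n + 1 ∧ z.2 < n + 1} ∧
      ∀ k ≤ n + 1, chain (fun i => ξ i ω) (W₀ ω) k ≠ chain (fun i => ξ i ω) (W₀' ω) k} with hA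
  have hint : ∫⁻ ω, (if (W₀ ω, W₀' ω) ∈ {z : ℕ × ℕ | z.1 < n + 1 ∧ z.2 < n + 1} then
      lyapunov B (p - 1 / 2) 0 (W₀ ω) (W₀' ω) else 0) ∂P ≤
      ENNReal.ofReal ((2 + B) ^ (p - 1 / 2) * (2 * (2 * C₁)) * ((n : ℝ) + 1) ^ (1 / 2 : ℝ)) := by
    have hm : ∀ (w : Ω → ℕ), Measurable w → Measurable fun ω =>
        (if w ω < n + 1 then ENNReal.ofReal (((w ω : ℝ) + 1) ^ (p - 1 / 2)) else 0) := fun w hw =>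
      (measurable_of_countable fun k : ℕ =>
        (if k < n + 1 then ENNReal.ofReal (((k : ℝ) + 1) ^ (p - 1 / 2)) else 0)).comp hw
    calc _ ≤ ∫⁻ ω, ENNReal.ofReal ((2 + B) ^ (p - 1 / 2)) *
          ((if W₀ ω < n + 1 then ENNReal.ofReal (((W₀ ω : ℝ) + 1) ^ (p - 1 / 2)) else 0) +
          (if W₀' ω < n + 1 then ENNReal.ofReal (((W₀' ω : ℝ) + 1) ^ (p - 1 / 2)) else 0)) ∂P := by
          refine lintegral_mono fun ω => ?_
          simp only [Set.mem_ofPred_eq]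
          by_cases h : W₀ ω < n + 1 ∧ W₀' ω < n + 1
          · rw [if_pos h, if_pos h.1, if_pos h.2]
            have key : lyapunov B (p - 1 / 2) 0 (W₀ ω) (W₀' ω) ≤
                ENNReal.ofReal ((2 + B) ^ (p - 1 / 2)) *
                ENNReal.ofReal ((((max (W₀ ω) (W₀' ω) : ℕ) : ℝ) + 1) ^ (p - 1 / 2)) := by
              have h0 : (0 : ℝ) ≤ ((max (W₀ ω) (W₀' ω) : ℕ) : ℝ) := by positivity
              rw [← ENNReal.ofReal_mul (by positivity), ← Real.mul_rpow (by linarith) (by linarith)]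
              refine ENNReal.ofReal_le_ofReal (Real.rpow_le_rpow ?_ ?_ (by linarith))
              · simp only [Nat.cast_zero]; linarith
              · simp only [Nat.cast_zero]; nlinarith
            refine key.trans ?_
            gcongr
            rcases le_total (W₀ ω) (W₀' ω) with hle | hle
            · rw [max_eq_right hle]; exact le_add_self
            · rw [max_eq_left hle]; exact le_self_add
          · rw [if_neg h]; simp
      _ = ENNReal.ofReal ((2 + B) ^ (p - 1 / 2)) *
          (∫⁻ ω, (if W₀ ω < n + 1 then ENNReal.ofReal (((W₀ ω : ℝ) + 1) ^ (p - 1 / 2)) else 0) ∂P +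
          ∫⁻ ω, (if W₀' ω < n + 1 then ENNReal.ofReal (((W₀' ω : ℝ) + 1) ^ (p - 1 / 2)) else 0)
            ∂P) := by
          rw [lintegral_const_mul' _ _ ENNReal.ofReal_ne_top, lintegral_add_left (hm W₀ hW)]
      _ ≤ ENNReal.ofReal ((2 + B) ^ (p - 1 / 2)) *
          (ENNReal.ofReal (2 * C₁ * ((n + 1 : ℕ) : ℝ) ^ (1 / 2 : ℝ)) +
          ENNReal.ofReal (2 * C₁ * ((n + 1 : ℕ) : ℝ) ^ (1 / 2 : ℝ))) := by
          gcongr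
          · exact lintegral_truncated_moment_le h₁ hC₁.le hW hl (n + 1)
          · exact lintegral_truncated_moment_le h₁ hC₁.le hW' hl' (n + 1)
      _ = _ := by
          rw [← ENNReal.ofReal_add (by positivity) (by positivity),
            ← ENNReal.ofReal_mul (by positivity)]
          push_cast
          ring_nf
  have hPA : P A ≤ ENNReal.ofReal ((2 + B) ^ (p - 1 / 2) * (2 * (2 * C₁)) *
      ((n : ℝ) + 1) ^ (-(p - 1))) := by
    have h3 : ENNReal.ofReal (((n + 1 : ℕ) : ℝ) ^ (p - 1 / 2)) * P A ≤ ENNReal.ofReal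
        ((2 + B) ^ (p - 1 / 2) * (2 * (2 * C₁)) * ((n : ℝ) + 1) ^ (1 / 2 : ℝ)) :=
      hmom.trans hint
    have hq : (0 : ℝ) < ((n + 1 : ℕ) : ℝ) ^ (p - 1 / 2) := by positivity
    refine (ENNReal.mul_le_mul_iff_right (a := ENNReal.ofReal (((n + 1 : ℕ) : ℝ) ^ (p - 1 / 2)))
      (by simpa using hq) ENNReal.ofReal_ne_top).1 (h3.trans (le_of_eq ?_))
    rw [← ENNReal.ofReal_mul hq.le]
    congr 1
    have he : ((n : ℝ) + 1) ^ (1 / 2 : ℝ)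
        = ((n : ℝ) + 1) ^ (p - 1 / 2) * ((n : ℝ) + 1) ^ (-(p - 1)) := by
      rw [← Real.rpow_add hn0]
      ring_nf
    push_cast
    rw [he]
    ring
  have htail : ∀ w : Ω → ℕ, Measurable w → (∀ j, P.real {ω | w ω = j} = statMass p j) →
      P {ω | n + 1 ≤ w ω} ≤ ENNReal.ofReal (C₂ * ((n : ℝ) + 1) ^ (-(p - 1))) := by
    intro w hw hlw
    rw [← ofReal_measureReal, ← (hasSum_tail hw hlw (n + 1)).tsum_eq]
    refine ENNReal.ofReal_le_ofReal ((h₂ (n + 1)).trans (mul_le_mul_of_nonneg_left ?_ hC₂.le))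
    refine Real.rpow_le_rpow_of_nonpos hn0 ?_ (by linarith)
    push_cast; linarith
  have hsub : {ω | ((n + 2 : ℕ) : ℕ∞) ≤ meetTime (fun i => ξ i ω) (W₀ ω) (W₀' ω)} ⊆
      A ∪ ({ω | n + 1 ≤ W₀ ω} ∪ {ω | n + 1 ≤ W₀' ω}) := by
    intro ω hω
    have h4 := (lt_meetTime_iff _ _ _ (n + 1)).1 hω
    simp only [hA, Set.mem_union, Set.mem_ofPred_eq]
    by_cases h5 : W₀ ω < n + 1 ∧ W₀' ω < n + 1
    · exact Or.inl ⟨h5, h4⟩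
    · right; omega
  calc _ ≤ P A + (P {ω | n + 1 ≤ W₀ ω} + P {ω | n + 1 ≤ W₀' ω}) :=
        (measure_mono hsub).trans ((measure_union_le _ _).trans
          (add_le_add le_rfl (measure_union_le _ _)))
    _ ≤ _ := add_le_add hPA (add_le_add (htail W₀ hW hl) (htail W₀' hW' hl'))
    _ = _ := by
        rw [← ENNReal.ofReal_add (by positivity) (by positivity),
          ← ENNReal.ofReal_add (by positivity) (by positivity)]
        congr 1
        ring

theorem chain_eq_sub (e : ℕ → ℕ) (w k : ℕ) (hk : k ≤ w) : chain e w k = w - k := by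
  induction k with
  | zero => rfl
  | succ k ih => rw [chain, ih (by omega), step, if_neg (by omega)]; omega

/-- A chain which starts below `N` and makes no jump larger than `N` stays below `N`. -/
theorem chain_lt (e : ℕ → ℕ) {w N k : ℕ} (hw : w < N) (he : ∀ i < k, e i ≤ N) :
    chain e w k < N := by
  induction k with
  | zero => exact hw
  | succ k ih =>
    have h1 := ih fun i hi => he i (by omega)
    have h2 := he k (by omega)
    rw [chain, step]
    split_ifs <;> omega

/-- A stationary chain started above `2 N` cannot meet before time `N` a chain which starts below
`N` and makes only jumps of size at most `N`. -/
theorem exists_le_meetTime_tail (hp : 2 < p) (hξ : ∀ i, Measurable (ξ i))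
    (hlaw : ∀ i k : ℕ, P.real {ω | ξ i ω = k} = innovMass p k)
    (hW : Measurable W₀) (hW' : Measurable W₀')
    (hl : ∀ j, P.real {ω | W₀ ω = j} = statMass p j)
    (hl' : ∀ j, P.real {ω | W₀' ω = j} = statMass p j)
    (hWξ : IndepFun W₀ (fun ω i => ξ i ω) P)
    (hWξ' : IndepFun W₀' (fun ω => (W₀ ω, fun i => ξ i ω)) P) :
    ∃ c : ℝ, 0 < c ∧ ∀ᶠ n : ℕ in atTop, ENNReal.ofReal (c * ((n : ℝ) + 1) ^ (-(p - 1))) ≤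
      P {ω | ((n + 1 : ℕ) : ℕ∞) ≤ meetTime (fun i => ξ i ω) (W₀ ω) (W₀' ω)} := by
  obtain ⟨c, hc, hlow⟩ := exists_le_statMass_tail hp
  obtain ⟨C₁, hC₁, h₁⟩ := exists_innovMass_tail_le hp
  obtain ⟨C₂, hC₂, h₂⟩ := exists_statMass_tail_le hp
  have hlim : Tendsto (fun n : ℕ => (C₂ + C₁) * ((n : ℝ) + 1) ^ (-(p - 1))) atTop (𝓝 0) := by
    have h3 := (tendsto_rpow_neg_atTop (show 0 < p - 1 by linarith)).comp
      (tendsto_atTop_add_const_right atTop (1 : ℝ) tendsto_natCast_atTop_atTop)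
    simpa using h3.const_mul (C₂ + C₁)
  refine ⟨c * 3 ^ (-(p - 1)) * (1 / 2), by positivity, ?_⟩
  filter_upwards [hlim.eventually_le_const (show (0 : ℝ) < 1 / 2 by norm_num)] with n hn
  have hn0 : (0 : ℝ) < (n : ℝ) + 1 := by positivity
  set N := n + 1 with hN
  set A : Set Ω := {ω | W₀' ω < N ∧ ∀ i < N, ξ i ω ≤ N} with hA
  have hAm : MeasurableSet A := by
    have : A = {ω | W₀' ω < N} ∩ ⋂ i : Fin N, {ω | ξ i ω ≤ N} := by
      ext ω
      simp only [hA, Set.mem_ofPred_eq, Set.mem_inter_iff, Set.mem_iInter]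
      exact ⟨fun h => ⟨h.1, fun i => h.2 i i.2⟩, fun h => ⟨h.1, fun i hi => h.2 ⟨i, hi⟩⟩⟩
    rw [this]
    exact (measurableSet_lt hW' measurable_const).inter
      (MeasurableSet.iInter fun i => measurableSet_le (hξ i) measurable_const)
  have hind : P.real ({ω | 2 * N ≤ W₀ ω} ∩ A) = P.real {ω | 2 * N ≤ W₀ ω} * P.real A := by
    have h1 : IndepFun (fun ω => (W₀' ω, fun i => ξ i ω)) W₀ P :=
      indepFun_prodMk_left hW' (measurable_pi_lambda _ hξ) hW
        (hWξ'.comp measurable_id measurable_swap) hWξ.symm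
    have hB : MeasurableSet {z : ℕ × (ℕ → ℕ) | z.1 < N ∧ ∀ i < N, z.2 i ≤ N} := by
      have : {z : ℕ × (ℕ → ℕ) | z.1 < N ∧ ∀ i < N, z.2 i ≤ N} =
          {z | z.1 < N} ∩ ⋂ i : Fin N, {z | z.2 i ≤ N} := by
        ext z
        simp only [Set.mem_ofPred_eq, Set.mem_inter_iff, Set.mem_iInter]
        exact ⟨fun h => ⟨h.1, fun i => h.2 i i.2⟩, fun h => ⟨h.1, fun i hi => h.2 ⟨i, hi⟩⟩⟩
      rw [this]
      exact (measurableSet_lt measurable_fst measurable_const).inter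
        (MeasurableSet.iInter fun i => measurableSet_le
          ((measurable_pi_apply _).comp measurable_snd) measurable_const)
    have h2 := h1.symm.measure_inter_preimage_eq_mul {k | 2 * N ≤ k} _
      (Set.to_countable _).measurableSet hB
    have h3 := congrArg ENNReal.toReal h2
    rw [ENNReal.toReal_mul] at h3
    exact h3
  have hAc : P.real Aᶜ ≤ 1 / 2 := by
    have hsub : Aᶜ ⊆ {ω | N ≤ W₀' ω} ∪ ⋃ i ∈ Finset.range N, {ω | N + 1 ≤ ξ i ω} := by
      intro ω hω
      simp only [hA, Set.mem_compl_iff, Set.mem_ofPred_eq, not_and_or, not_lt, not_forall,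
        not_le] at hω
      rcases hω with h | ⟨i, hi, h⟩
      · exact Or.inl h
      · exact Or.inr (Set.mem_biUnion (Finset.mem_coe.2 (Finset.mem_range.2 hi)) h)
    have h4 : P.real {ω | N ≤ W₀' ω} ≤ C₂ * ((n : ℝ) + 1) ^ (-(p - 1)) := by
      rw [← (hasSum_tail hW' hl' N).tsum_eq]
      refine (h₂ N).trans (mul_le_mul_of_nonneg_left ?_ hC₂.le)
      refine Real.rpow_le_rpow_of_nonpos hn0 ?_ (by linarith)
      rw [hN]; push_cast; linarith
    have h5 : ∀ i ∈ Finset.range N, P.real {ω | N + 1 ≤ ξ i ω} ≤ C₁ * ((n : ℝ) + 1) ^ (-p) := by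
      intro i _
      rw [← (hasSum_tail (hξ i) (hlaw i) (N + 1)).tsum_eq]
      refine (h₁ N).trans (mul_le_mul_of_nonneg_left ?_ hC₁.le)
      refine Real.rpow_le_rpow_of_nonpos hn0 ?_ (by linarith)
      rw [hN]; push_cast; linarith
    calc P.real Aᶜ ≤ P.real {ω | N ≤ W₀' ω}
          + P.real (⋃ i ∈ Finset.range N, {ω | N + 1 ≤ ξ i ω}) :=
          (measureReal_mono hsub).trans (measureReal_union_le _ _)
      _ ≤ C₂ * ((n : ℝ) + 1) ^ (-(p - 1)) + ∑ i ∈ Finset.range N, P.real {ω | N + 1 ≤ ξ i ω} :=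
          add_le_add h4 (measureReal_biUnion_finset_le _ _)
      _ ≤ C₂ * ((n : ℝ) + 1) ^ (-(p - 1)) + N • (C₁ * ((n : ℝ) + 1) ^ (-p)) := by
          gcongr
          simpa using Finset.sum_le_card_nsmul _ _ _ h5
      _ = (C₂ + C₁) * ((n : ℝ) + 1) ^ (-(p - 1)) := by
          rw [show -(p - 1) = -p + 1 by ring, Real.rpow_add_one hn0.ne', nsmul_eq_mul, hN]
          push_cast
          ring
      _ ≤ 1 / 2 := hn
  have hA2 : 1 / 2 ≤ P.real A := by
    have := measureReal_add_measureReal_compl (μ := P) hAm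
    rw [probReal_univ] at this
    linarith
  have hWlow : c * 3 ^ (-(p - 1)) * ((n : ℝ) + 1) ^ (-(p - 1)) ≤ P.real {ω | 2 * N ≤ W₀ ω} := by
    rw [← (hasSum_tail hW hl (2 * N)).tsum_eq]
    refine le_trans ?_ (hlow (2 * N))
    rw [mul_assoc, ← Real.mul_rpow (by norm_num) hn0.le]
    refine mul_le_mul_of_nonneg_left ?_ hc.le
    refine Real.rpow_le_rpow_of_nonpos (by positivity) ?_ (by linarith)
    rw [hN]; push_cast; linarith [n.cast_nonneg (α := ℝ)]
  have hsub : {ω | 2 * N ≤ W₀ ω} ∩ A ⊆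
      {ω | ((n + 1 : ℕ) : ℕ∞) ≤ meetTime (fun i => ξ i ω) (W₀ ω) (W₀' ω)} := by
    rintro ω ⟨h6, h7, h8⟩
    refine (lt_meetTime_iff _ _ _ n).2 fun k hk => ?_
    have h9 := chain_lt (fun i => ξ i ω) (k := k) h7 fun i hi => h8 i (by omega)
    simp only [Set.mem_ofPred_eq] at h6
    rw [chain_eq_sub _ _ _ (by omega)]
    omega
  refine le_trans ?_ (measure_mono hsub)
  rw [← ofReal_measureReal, hind]
  refine ENNReal.ofReal_le_ofReal ?_
  calc _ = c * 3 ^ (-(p - 1)) * ((n : ℝ) + 1) ^ (-(p - 1)) * (1 / 2) := by ring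
    _ ≤ _ := by gcongr

end Meeting

theorem tsum_eq_top_of_eventually_ge {f : ℕ → ℝ≥0∞} {c : ℝ} (hc : 0 < c)
    (h : ∀ᶠ n : ℕ in atTop, ENNReal.ofReal (c * ((n : ℝ) + 1)⁻¹) ≤ f n) : ∑' n, f n = ⊤ := by
  by_contra hne
  obtain ⟨M, hM⟩ := eventually_atTop.1 h
  have h1 : ∑' n, f (n + M) ≠ ⊤ :=
    ne_top_of_le_ne_top hne (ENNReal.tsum_comp_le_tsum_of_injective (add_left_injective M) f)
  have h2 : ∑' n : ℕ, ENNReal.ofReal (c * (((n + M : ℕ) : ℝ) + 1)⁻¹) ≠ ⊤ :=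
    ne_top_of_le_ne_top h1 (ENNReal.tsum_le_tsum fun n => hM _ (by omega))
  have h3 := (ENNReal.summable_toReal h2).mul_left c⁻¹
  refine Real.not_summable_natCast_inv ((summable_nat_add_iff (M + 1)).1 (h3.congr fun n => ?_))
  rw [ENNReal.toReal_ofReal (by positivity), inv_mul_cancel_left₀ hc.ne']
  push_cast
  ring_nf


section Series

variable {Ω : Type*} [MeasurableSpace Ω] {P : Measure Ω} [IsProbabilityMeasure P]
  {ξ : ℕ → Ω → ℕ} {W₀ W₀' : Ω → ℕ}

theorem tsum_meetTime_eq_top (hp : 2 < p) (hξ : ∀ i, Measurable (ξ i))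
    (hlaw : ∀ i k : ℕ, P.real {ω | ξ i ω = k} = innovMass p k)
    (hW : Measurable W₀) (hW' : Measurable W₀')
    (hl : ∀ j, P.real {ω | W₀ ω = j} = statMass p j)
    (hl' : ∀ j, P.real {ω | W₀' ω = j} = statMass p j)
    (hWξ : IndepFun W₀ (fun ω i => ξ i ω) P)
    (hWξ' : IndepFun W₀' (fun ω => (W₀ ω, fun i => ξ i ω)) P) :
    ∑' n : ℕ, ENNReal.ofReal (((n : ℝ) + 1) ^ (p - 2)) *
      P {ω | ((n + 1 : ℕ) : ℕ∞) ≤ meetTime (fun i => ξ i ω) (W₀ ω) (W₀' ω)} = ⊤ := by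
  obtain ⟨c, hc, h⟩ := exists_le_meetTime_tail hp hξ hlaw hW hW' hl hl' hWξ hWξ'
  refine tsum_eq_top_of_eventually_ge hc ?_
  filter_upwards [h] with n hn
  have hn0 : (0 : ℝ) < (n : ℝ) + 1 := by positivity
  refine le_trans (le_of_eq ?_) (mul_le_mul_right hn _)
  rw [← ENNReal.ofReal_mul (by positivity), mul_left_comm, ← Real.rpow_add hn0,
    ← Real.rpow_neg_one]
  ring_nf

theorem tsum_meetTime_lt_top (hp : 2 < p) (hξ : ∀ i, Measurable (ξ i))
    (hlaw : ∀ i k : ℕ, P.real {ω | ξ i ω = k} = innovMass p k) (hind : iIndepFun ξ P)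
    (hW : Measurable W₀) (hW' : Measurable W₀')
    (hl : ∀ j, P.real {ω | W₀ ω = j} = statMass p j)
    (hl' : ∀ j, P.real {ω | W₀' ω = j} = statMass p j)
    (hWξ : IndepFun W₀ (fun ω i => ξ i ω) P)
    (hWξ' : IndepFun W₀' (fun ω => (W₀ ω, fun i => ξ i ω)) P) {ε : ℝ} (hε : 0 < ε) :
    ∑' n : ℕ, ENNReal.ofReal (((n : ℝ) + 2) ^ (p - 2) * Real.log ((n : ℝ) + 2) ^ (-(1 + ε))) *
      P {ω | ((n + 2 : ℕ) : ℕ∞) ≤ meetTime (fun i => ξ i ω) (W₀ ω) (W₀' ω)} < ⊤ := by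
  obtain ⟨C, hC, h⟩ := exists_meetTime_tail_le hp hξ hlaw hind hW hW' hl hl' hWξ hWξ'
  have hbound : ∀ n : ℕ,
      ENNReal.ofReal (((n : ℝ) + 2) ^ (p - 2) * Real.log ((n : ℝ) + 2) ^ (-(1 + ε))) *
      P {ω | ((n + 2 : ℕ) : ℕ∞) ≤ meetTime (fun i => ξ i ω) (W₀ ω) (W₀' ω)} ≤
      ENNReal.ofReal (C * 2 ^ (p - 1) *
        (((n : ℝ) + 2)⁻¹ * Real.log ((n : ℝ) + 2) ^ (-(1 + ε)))) := by
    intro n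
    have hn2 : (0 : ℝ) < (n : ℝ) + 2 := by positivity
    have hn1 : (0 : ℝ) < (n : ℝ) + 1 := by positivity
    have hlog : 0 < Real.log ((n : ℝ) + 2) := Real.log_pos (by linarith)
    refine (mul_le_mul_right (h n) _).trans ?_
    rw [← ENNReal.ofReal_mul (by positivity)]
    refine ENNReal.ofReal_le_ofReal ?_
    have h1 : ((n : ℝ) + 1) ^ (-(p - 1)) ≤ 2 ^ (p - 1) * ((n : ℝ) + 2) ^ (-(p - 1)) := by
      calc ((n : ℝ) + 1) ^ (-(p - 1)) ≤ (((n : ℝ) + 2) / 2) ^ (-(p - 1)) :=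
            Real.rpow_le_rpow_of_nonpos (by positivity) (by linarith [n.cast_nonneg (α := ℝ)])
              (by linarith)
        _ = _ := by
            rw [Real.div_rpow hn2.le (by norm_num), Real.rpow_neg (by norm_num : (0 : ℝ) ≤ 2)]
            field_simp
    calc _ ≤ ((n : ℝ) + 2) ^ (p - 2) * Real.log ((n : ℝ) + 2) ^ (-(1 + ε)) *
          (C * (2 ^ (p - 1) * ((n : ℝ) + 2) ^ (-(p - 1)))) := by gcongr
      _ = C * 2 ^ (p - 1) * ((((n : ℝ) + 2) ^ (p - 2) * ((n : ℝ) + 2) ^ (-(p - 1))) *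
          Real.log ((n : ℝ) + 2) ^ (-(1 + ε))) := by ring
      _ = _ := by
          rw [← Real.rpow_add hn2, ← Real.rpow_neg_one]
          ring_nf
  refine (ENNReal.tsum_le_tsum hbound).trans_lt ?_
  exact ((summable_inv_mul_log_rpow hε).mul_left _).tsum_ofReal_lt_top

end Series

/-! ### Visits of the chain to `0` -/

section Visits

variable {Ω : Type*} [MeasurableSpace Ω] {P : Measure Ω} [IsProbabilityMeasure P]
  {ξ : ℕ → Ω → ℕ} {W₀ : Ω → ℕ}

theorem memLp_innov (hp : 2 < p) {X : Ω → ℕ} (hX : Measurable X)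
    (hlaw : ∀ k : ℕ, P.real {ω | X ω = k} = innovMass p k) : MemLp (fun ω => (X ω : ℝ)) 2 P := by
  have hm : Measurable fun ω => (X ω : ℝ) := measurable_from_nat.comp hX
  rw [memLp_two_iff_integrable_sq hm.aestronglyMeasurable]
  refine ⟨(hm.pow_const 2).aestronglyMeasurable, ?_⟩
  rw [hasFiniteIntegral_iff_ofReal (ae_of_all _ fun ω => by positivity),
    lintegral_comp_nat hX (fun k => ENNReal.ofReal ((k : ℝ) ^ 2))]
  refine lt_of_eq_of_lt (tsum_congr fun k => ?_)
    (summable_rpow_mul_innovMass (p := p) (q := 2) hp).tsum_ofReal_lt_top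
  rw [measure_eq_ofReal hlaw, ← ENNReal.ofReal_mul (by positivity)]
  norm_cast

theorem integral_innov (hp : 2 < p) {X : Ω → ℕ} (hX : Measurable X)
    (hlaw : ∀ k : ℕ, P.real {ω | X ω = k} = innovMass p k) :
    ∫ ω, (X ω : ℝ) ∂P = ∑' k : ℕ, (k : ℝ) * innovMass p k := by
  have h1 : ∫ ω, (X ω : ℝ) ∂P = ∫ k, (k : ℝ) ∂(P.map X) :=
    (integral_map hX.aemeasurable measurable_from_nat.aestronglyMeasurable).symm
  have h2 : Integrable (fun k : ℕ => (k : ℝ)) (P.map X) :=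
    (integrable_map_measure measurable_from_nat.aestronglyMeasurable hX.aemeasurable).2
      ((memLp_innov hp hX hlaw).integrable one_le_two)
  rw [h1, integral_countable h2]
  refine tsum_congr fun k => ?_
  rw [map_measureReal_apply hX (measurableSet_singleton k), smul_eq_mul, mul_comm, ← hlaw]
  rfl

theorem identDistrib_innov {X Y : Ω → ℕ} (hX : Measurable X) (hY : Measurable Y)
    (hlaw : ∀ k : ℕ, P.real {ω | X ω = k} = innovMass p k)
    (hlaw' : ∀ k : ℕ, P.real {ω | Y ω = k} = innovMass p k) : IdentDistrib X Y P P := by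
  refine ⟨hX.aemeasurable, hY.aemeasurable, Measure.ext_of_singleton fun k => ?_⟩
  rw [Measure.map_apply hX (measurableSet_singleton k),
    Measure.map_apply hY (measurableSet_singleton k)]
  exact (measure_eq_ofReal hlaw k).trans (measure_eq_ofReal hlaw' k).symm

/-- The innovations used at the visits to `0`, centred and weighted, form a martingale transform
which converges almost surely when the weights are square summable. -/
theorem ae_tendsto_weighted_sum (hp : 2 < p) (hξ : ∀ i, Measurable (ξ i))
    (hlaw : ∀ i k : ℕ, P.real {ω | ξ i ω = k} = innovMass p k) (hind : iIndepFun ξ P)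
    (hW : Measurable W₀) (hWξ : IndepFun W₀ (fun ω i => ξ i ω) P)
    {a : ℕ → ℝ} (ha : Summable fun k => a k ^ 2) :
    ∀ᵐ ω ∂P, ∃ c, Tendsto (fun n => ∑ k ∈ Finset.range n,
      a k * (if chain (fun i => ξ i ω) (W₀ ω) k = 0 then 1 else 0) *
        ((ξ k ω : ℝ) - ∑' k : ℕ, (k : ℝ) * innovMass p k)) atTop (𝓝 c) := by
  set μ : ℝ := ∑' k : ℕ, (k : ℝ) * innovMass p k with hμ
  set ℱ := past W₀ hW ξ hξ with hℱ
  set c : ℕ → Ω → ℝ := fun k ω =>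
    a k * (if chain (fun i => ξ i ω) (W₀ ω) k = 0 then 1 else 0) with hc
  set Y : ℕ → Ω → ℝ := fun k ω => (ξ k ω : ℝ) - μ with hY
  set M : ℕ → Ω → ℝ := fun n ω => ∑ k ∈ Finset.range n, c k ω * Y k ω with hM
  have hcm : ∀ k, Measurable[ℱ k] (c k) := fun k =>
    (measurable_of_countable fun z : ℕ => a k * (if z = 0 then 1 else 0)).comp
      (measurable_past_chain (w := id) measurable_id k)
  have hcb : ∀ k ω, |c k ω| ≤ |a k| := by
    intro k ω
    simp only [hc]
    split_ifs <;> simp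
  have hYm : ∀ k, Measurable[MeasurableSpace.comap (ξ k) inferInstance] (Y k) := fun k =>
    (measurable_of_countable fun z : ℕ => (z : ℝ) - μ).comp (comap_measurable (ξ k))
  have hYm0 : ∀ k, Measurable (Y k) := fun k => (hYm k).mono (hξ k).comap_le le_rfl
  have hYL : ∀ k, MemLp (Y k) 2 P := fun k =>
    (memLp_innov hp (hξ k) (hlaw k)).sub (memLp_const μ)
  have hYint : ∀ k, ∫ ω, Y k ω ∂P = 0 := by
    intro k
    simp only [hY]
    rw [integral_sub ((memLp_innov hp (hξ k) (hlaw k)).integrable one_le_two)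
      (integrable_const μ), integral_innov hp (hξ k) (hlaw k)]
    simp [hμ]
  have hYsq : ∀ k, ∫ ω, Y k ω ^ 2 ∂P = ∫ ω, Y 0 ω ^ 2 ∂P := fun k =>
    ((identDistrib_innov (hξ k) (hξ 0) (hlaw k) (hlaw 0)).comp
      (u := fun z : ℕ => ((z : ℝ) - μ) ^ 2) (measurable_of_countable _)).integral_eq
  have hcm0 : ∀ k, Measurable (c k) := fun k => (hcm k).mono (ℱ.le k) le_rfl
  have htermL : ∀ k, MemLp (fun ω => c k ω * Y k ω) 2 P := fun k =>
    ((hYL k).const_mul (a k)).mono ((hcm0 k).mul (hYm0 k)).aestronglyMeasurable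
      (ae_of_all _ fun ω => calc
        ‖c k ω * Y k ω‖ = |c k ω| * ‖Y k ω‖ := norm_mul _ _
        _ ≤ |a k| * ‖Y k ω‖ := mul_le_mul_of_nonneg_right (hcb k ω) (norm_nonneg _)
        _ = ‖a k * Y k ω‖ := by rw [norm_mul, Real.norm_eq_abs (a k)])
  have hML : ∀ n, MemLp (M n) 2 P := fun n => memLp_finsetSum (Finset.range n) fun k _ => htermL k
  have hMm : ∀ n, Measurable[ℱ n] (M n) := by
    intro n
    refine Finset.measurable_sum _ fun k hk => ?_
    have hkn := Finset.mem_range.1 hk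
    refine ((hcm k).mono (ℱ.mono hkn.le) le_rfl).mul ?_
    exact (measurable_of_countable fun z : ℕ => (z : ℝ) - μ).comp (measurable_past_innov hkn)
  have hMs : ∀ n ω, M (n + 1) ω = M n ω + c n ω * Y n ω := fun n ω => Finset.sum_range_succ _ _
  have hmart : Martingale M ℱ P := by
    refine martingale_nat (fun n => (hMm n).stronglyMeasurable)
      (fun n => (hML n).integrable one_le_two) fun n => ?_
    have h1 : M (n + 1) = M n + c n * Y n := funext (hMs n)
    have h2 : P[M n | ℱ n] = M n := condExp_of_stronglyMeasurable (ℱ.le n)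
      (hMm n).stronglyMeasurable ((hML n).integrable one_le_two)
    have h3 := condExp_mul_of_stronglyMeasurable_left (μ := P) (m := ℱ n) (f := c n) (g := Y n)
      (hcm n).stronglyMeasurable ((htermL n).integrable one_le_two)
      ((hYL n).integrable one_le_two)
    have h4 := condExp_indep_eq (μ := P) (hξ n).comap_le (ℱ.le n) (hYm n).stronglyMeasurable
      (indep_past (hX := hW) (hξ := hξ) hind hWξ n).symm
    have h5 := condExp_add (μ := P) ((hML n).integrable one_le_two)
      ((htermL n).integrable one_le_two) (ℱ n)
    rw [h1]
    filter_upwards [h3, h4, h5] with ω h3 h4 h5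
    have h6 : (P[M n + c n * Y n | ℱ n]) ω = (P[M n | ℱ n] + P[c n * Y n | ℱ n]) ω := h5
    rw [h6, Pi.add_apply, h2, h3, Pi.mul_apply, h4, hYint]
    simp
  -- the increments of `M` are orthogonal, so its second moment is bounded
  have hsq : ∀ n, ∫ ω, M n ω ^ 2 ∂P ≤ ∑ k ∈ Finset.range n, a k ^ 2 * ∫ ω, Y 0 ω ^ 2 ∂P := by
    intro n
    induction n with
    | zero => simp [hM]
    | succ n ih =>
      have h1 : ∀ ω, M (n + 1) ω ^ 2 = M n ω ^ 2 + 2 * ((M n ω * c n ω) * Y n ω)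
          + (c n ω * Y n ω) ^ 2 := fun ω => by rw [hMs]; ring
      have hi1 := (hML n).integrable_sq
      have hi2 : Integrable (fun ω => (M n ω * c n ω) * Y n ω) P :=
        ((hML n).integrable_mul (htermL n)).congr (ae_of_all _ fun ω => by
          simp only [Pi.mul_apply]; ring)
      have hi3 := (htermL n).integrable_sq
      have h2 : ∫ ω, (M n ω * c n ω) * Y n ω ∂P = 0 := by
        have hind' : IndepFun (fun ω => M n ω * c n ω) (Y n) P :=
          (indepFun_of_measurable_past (hX := hW) (hξ := hξ) hind hWξ ((hMm n).mul (hcm n))).comp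
            (φ := id) (ψ := fun z : ℕ => (z : ℝ) - μ) measurable_id (measurable_of_countable _)
        rw [hind'.integral_fun_mul_eq_mul_integral
          (((hMm n).mul (hcm n)).mono (ℱ.le n) le_rfl).aestronglyMeasurable
          (hYm0 n).aestronglyMeasurable, hYint, mul_zero]
      have h3 : ∫ ω, (c n ω * Y n ω) ^ 2 ∂P ≤ a n ^ 2 * ∫ ω, Y 0 ω ^ 2 ∂P := by
        rw [← hYsq n, ← integral_const_mul]
        refine integral_mono hi3 ((hYL n).integrable_sq.const_mul _) fun ω => ?_
        simp only [mul_pow]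
        exact mul_le_mul_of_nonneg_right (sq_le_sq.2 (hcb n ω)) (sq_nonneg _)
      have h4 : ∫ ω, (M n ω ^ 2 + 2 * ((M n ω * c n ω) * Y n ω) + (c n ω * Y n ω) ^ 2) ∂P =
          ∫ ω, (M n ω ^ 2 + 2 * ((M n ω * c n ω) * Y n ω)) ∂P + ∫ ω, (c n ω * Y n ω) ^ 2 ∂P :=
        integral_add (hi1.add (hi2.const_mul 2)) hi3
      simp only [h1]
      rw [h4, integral_add hi1 (hi2.const_mul 2), integral_const_mul, h2, Finset.sum_range_succ]
      linarith
  have hV : 0 ≤ ∫ ω, Y 0 ω ^ 2 ∂P := integral_nonneg fun ω => sq_nonneg _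
  refine hmart.submartingale.exists_ae_tendsto_of_bdd
    (R := (1 + (∑' k, a k ^ 2) * ∫ ω, Y 0 ω ^ 2 ∂P).toNNReal) fun n => ?_
  rw [eLpNorm_one_eq_lintegral_enorm,
    ← ofReal_integral_norm_eq_lintegral_enorm ((hML n).integrable one_le_two)]
  refine ENNReal.ofReal_le_ofReal ?_
  calc ∫ ω, ‖M n ω‖ ∂P ≤ ∫ ω, (1 + M n ω ^ 2) ∂P := by
        refine integral_mono ((hML n).integrable one_le_two).norm
          ((integrable_const 1).add (hML n).integrable_sq) fun ω => ?_
        simp only [Real.norm_eq_abs]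
        nlinarith [sq_abs (M n ω), sq_nonneg (|M n ω| - 1)]
    _ = 1 + ∫ ω, M n ω ^ 2 ∂P := by
        rw [integral_add (integrable_const 1) (hML n).integrable_sq]
        simp
    _ ≤ 1 + ∑ k ∈ Finset.range n, a k ^ 2 * ∫ ω, Y 0 ω ^ 2 ∂P := by gcongr; exact hsq n
    _ ≤ _ := by
        rw [← Finset.sum_mul]
        gcongr
        exact ha.sum_le_tsum _ fun k _ => sq_nonneg _

/-- The chain decreases by one at each step, except that it jumps by `ξ - 1` from `0`. Weighting
this identity by a decreasing sequence `a` and summing by parts gives a lower bound for the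
weighted sum of the jumps. -/
theorem le_weighted_sum_jumps {a : ℕ → ℝ} (ha : Antitone a) {e : ℕ → ℕ}
    (he : ∀ i, e i ≠ 0) (w n : ℕ) :
    ∑ k ∈ Finset.range n, a k - a 0 * w + a n * chain e w n ≤
      ∑ k ∈ Finset.range n, a k * (if chain e w k = 0 then 1 else 0) * (e k : ℝ) := by
  induction n with
  | zero => simp [chain]
  | succ n ih =>
    rw [Finset.sum_range_succ, Finset.sum_range_succ]
    have h1 : (chain e w (n + 1) : ℝ) =
        chain e w n - 1 + (if chain e w n = 0 then 1 else 0) * (e n : ℝ) := by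
      rw [chain, step]
      have h2 := he n
      split_ifs with h
      · rw [Nat.cast_sub (by omega), h]; push_cast; ring
      · rw [Nat.cast_sub (by omega)]; push_cast; ring
    have h3 : a (n + 1) * chain e w (n + 1) ≤ a n * chain e w (n + 1) :=
      mul_le_mul_of_nonneg_right (ha n.le_succ) (by positivity)
    have h4 : a n * chain e w (n + 1) = a n * chain e w n - a n
        + a n * (if chain e w n = 0 then 1 else 0) * (e n : ℝ) := by rw [h1]; ring
    linarith

theorem ae_innov_ne_zero (hlaw : ∀ i k : ℕ, P.real {ω | ξ i ω = k} = innovMass p k) :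
    ∀ᵐ ω ∂P, ∀ i, ξ i ω ≠ 0 := by
  rw [ae_all_iff]
  intro i
  rw [ae_iff]
  simpa [innovMass_zero] using measure_eq_ofReal (hlaw i) 0

/-- The visits to `0` are so frequent that decreasing weights with divergent sum still have a
divergent sum along them. -/
theorem ae_tendsto_weighted_visits (hp : 2 < p) (hξ : ∀ i, Measurable (ξ i))
    (hlaw : ∀ i k : ℕ, P.real {ω | ξ i ω = k} = innovMass p k) (hind : iIndepFun ξ P)
    (hW : Measurable W₀) (hWξ : IndepFun W₀ (fun ω i => ξ i ω) P)
    {a : ℕ → ℝ} (ha0 : ∀ k, 0 ≤ a k) (hanti : Antitone a) (ha2 : Summable fun k => a k ^ 2)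
    (ha : ¬ Summable a) :
    ∀ᵐ ω ∂P, Tendsto (fun n => ∑ k ∈ Finset.range n,
      a k * (if chain (fun i => ξ i ω) (W₀ ω) k = 0 then 1 else 0)) atTop atTop := by
  filter_upwards [ae_tendsto_weighted_sum hp hξ hlaw hind hW hWξ ha2,
    ae_innov_ne_zero hlaw] with ω ⟨c, hc⟩ hne
  have hμ := mean_pos hp
  set μ : ℝ := ∑' k : ℕ, (k : ℝ) * innovMass p k with hμdef
  set Z : ℕ → ℕ := chain (fun i => ξ i ω) (W₀ ω) with hZ
  have hdiv : Tendsto (fun n => ∑ k ∈ Finset.range n, a k) atTop atTop :=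
    (not_summable_iff_tendsto_nat_atTop_of_nonneg ha0).1 ha
  have h1 : Tendsto (fun n => ∑ k ∈ Finset.range n, a k + (-(a 0 * W₀ ω) -
      ∑ k ∈ Finset.range n, a k * (if Z k = 0 then 1 else 0) * ((ξ k ω : ℝ) - μ))) atTop atTop :=
    hdiv.atTop_add (tendsto_const_nhds.sub hc)
  refine (tendsto_atTop_mono (fun n => ?_) (h1.const_mul_atTop (inv_pos.2 hμ)))
  have h2 := le_weighted_sum_jumps hanti hne (W₀ ω) n
  have h3 : 0 ≤ a n * (Z n : ℝ) := mul_nonneg (ha0 n) (by positivity)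
  have h4 : ∑ k ∈ Finset.range n, a k * (if Z k = 0 then 1 else 0) * ((ξ k ω : ℝ) - μ) =
      ∑ k ∈ Finset.range n, a k * (if Z k = 0 then 1 else 0) * (ξ k ω : ℝ)
      - μ * ∑ k ∈ Finset.range n, a k * (if Z k = 0 then 1 else 0) := by
    rw [Finset.mul_sum, ← Finset.sum_sub_distrib]
    exact Finset.sum_congr rfl fun k _ => by ring
  rw [inv_mul_le_iff₀ hμ, h4]
  linarith

/-- Infinitely often the chain makes a jump larger than `ℓ k` at a visit to `0` at time `k`. -/
theorem ae_frequently_large_jump (hp : 2 < p) (hξ : ∀ i, Measurable (ξ i))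
    (hlaw : ∀ i k : ℕ, P.real {ω | ξ i ω = k} = innovMass p k) (hind : iIndepFun ξ P)
    (hW : Measurable W₀) (hWξ : IndepFun W₀ (fun ω i => ξ i ω) P)
    {a : ℕ → ℝ} (ha0 : ∀ k, 0 ≤ a k) (hanti : Antitone a) (ha2 : Summable fun k => a k ^ 2)
    (ha : ¬ Summable a) {ℓ : ℕ → ℕ} {c : ℝ} (hc : 0 < c)
    (hℓ : ∀ k, c * a k ≤ ∑' i : ℕ, innovMass p (i + ℓ k + 1)) :
    ∀ᵐ ω ∂P, ∃ᶠ k in atTop, chain (fun i => ξ i ω) (W₀ ω) k = 0 ∧ ℓ k < ξ k ω := by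
  set ℱ := past W₀ hW ξ hξ with hℱ
  set Z : ℕ → Ω → ℕ := fun k ω => chain (fun i => ξ i ω) (W₀ ω) k with hZ
  have hZm : ∀ k, Measurable[ℱ k] (Z k) := fun k =>
    measurable_past_chain (w := id) measurable_id k
  -- `s (k + 1)` is the event of a large jump at time `k`, which is known at time `k + 1`
  set s : ℕ → Set Ω := fun n => Nat.casesOn n ∅ fun k => {ω | Z k ω = 0 ∧ ℓ k < ξ k ω} with hs
  have hsm : ∀ n, MeasurableSet[ℱ n] (s n) := by
    intro n
    cases n with
    | zero => exact @MeasurableSet.empty _ (ℱ 0)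
    | succ k =>
      have h1 := (hZm k).mono (ℱ.mono k.le_succ) le_rfl
      have h2 : Measurable[ℱ (k + 1)] (ξ k) := measurable_past_innov k.lt_succ_self
      exact (h1.prodMk h2) ({z : ℕ × ℕ | z.1 = 0 ∧ ℓ k < z.2}.to_countable.measurableSet)
  have hcond : ∀ k, P[(s (k + 1)).indicator (1 : Ω → ℝ) | ℱ k] =ᵐ[P] fun ω =>
      (if Z k ω = 0 then 1 else 0) * ∑' i : ℕ, innovMass p (i + ℓ k + 1) := by
    intro k
    set f : Ω → ℝ := fun ω => if Z k ω = 0 then 1 else 0 with hf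
    set g : Ω → ℝ := fun ω => if ℓ k < ξ k ω then 1 else 0 with hg
    have hfm : Measurable[ℱ k] f :=
      (measurable_of_countable fun z : ℕ => (if z = 0 then 1 else 0 : ℝ)).comp (hZm k)
    have hgm : Measurable[MeasurableSpace.comap (ξ k) inferInstance] g :=
      (measurable_of_countable fun z : ℕ => (if ℓ k < z then 1 else 0 : ℝ)).comp
        (comap_measurable (ξ k))
    have hgm0 : Measurable g := hgm.mono (hξ k).comap_le le_rfl
    have hfm0 : Measurable f := hfm.mono (ℱ.le k) le_rfl
    have hgi : Integrable g P := Integrable.of_bound hgm0.aestronglyMeasurable 1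
      (ae_of_all _ fun ω => by simp only [hg]; split_ifs <;> simp)
    have hfgi : Integrable (f * g) P := Integrable.of_bound (hfm0.mul hgm0).aestronglyMeasurable 1
      (ae_of_all _ fun ω => by simp only [hf, hg, Pi.mul_apply]; split_ifs <;> simp)
    have hfg : (s (k + 1)).indicator (1 : Ω → ℝ) = f * g := by
      ext ω
      simp only [hs, hf, hg, Set.indicator_apply, Set.mem_ofPred_eq, Pi.mul_apply, Pi.one_apply]
      by_cases h1 : Z k ω = 0 <;> by_cases h2 : ℓ k < ξ k ω <;> simp [h1, h2]
    have hgint : ∫ ω, g ω ∂P = ∑' i : ℕ, innovMass p (i + ℓ k + 1) := by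
      have h1 : g = Set.indicator {ω | ℓ k + 1 ≤ ξ k ω} 1 := by
        ext ω
        simp [hg, Set.indicator_apply]
      rw [h1, integral_indicator_one (measurableSet_le measurable_const (hξ k))]
      exact (hasSum_tail (hξ k) (hlaw k) (ℓ k + 1)).tsum_eq.symm
    have h3 := condExp_mul_of_stronglyMeasurable_left (μ := P) (m := ℱ k) (f := f) (g := g)
      hfm.stronglyMeasurable hfgi hgi
    have h4 := condExp_indep_eq (μ := P) (hξ k).comap_le (ℱ.le k) hgm.stronglyMeasurable
      (indep_past (hX := hW) (hξ := hξ) hind hWξ k).symm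
    rw [hfg]
    filter_upwards [h3, h4] with ω h3 h4
    rw [h3, Pi.mul_apply, h4, hgint]
  filter_upwards [ae_mem_limsup_atTop_iff P hsm, ae_all_iff.2 hcond,
    ae_tendsto_weighted_visits hp hξ hlaw hind hW hWξ ha0 hanti ha2 ha] with ω h1 h2 h3
  have h5 : ω ∈ limsup s atTop := by
    refine h1.2 ?_
    simp only [h2]
    refine tendsto_atTop_mono (fun n => ?_) (h3.const_mul_atTop hc)
    rw [Finset.mul_sum]
    refine Finset.sum_le_sum fun k _ => ?_
    rw [← mul_assoc, mul_comm]
    exact mul_le_mul_of_nonneg_left (hℓ k) (by split_ifs <;> norm_num)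
  rw [← limsup_nat_add s 1, mem_limsup_iff_frequently_mem] at h5
  exact h5

end Visits

/-! ### Partial sums of the Gaussian sequence -/

section Gaussian

variable {Ω : Type*} [MeasurableSpace Ω] {P : Measure Ω} [IsProbabilityMeasure P] {g : ℤ → Ω → ℝ}

theorem IsStationaryProcess.covariance_eq (hst : IsStationaryProcess g P)
    (hm : ∀ k, MemLp (g k) 2 P) (i j : ℤ) : cov[g i, g j; P] = cov[g 0, g (j - i); P] := by
  have h1 : ∀ f : (ℤ → ℝ) → ℝ, Measurable f →
      ∫ ω, f (fun k => g (k + i) ω) ∂P = ∫ ω, f (fun k => g k ω) ∂P := fun f hf =>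
    ((hst i).comp hf).integral_eq
  rw [covariance_eq_sub (hm i) (hm j), covariance_eq_sub (hm 0) (hm (j - i))]
  have h2 := h1 (fun x => x 0 * x (j - i))
    ((measurable_pi_apply _).mul (measurable_pi_apply _))
  have h3 := h1 (fun x => x 0) (measurable_pi_apply _)
  have h4 := h1 (fun x => x (j - i)) (measurable_pi_apply _)
  simp only [zero_add, sub_add_cancel] at h2 h3 h4
  simp only [Pi.mul_apply, h2, h3, h4]

/-- The variance of `g_1 + ⋯ + g_n` grows at most linearly, since its increments are controlled by
the partial sums of the series of covariances. -/
theorem exists_variance_sum_le (hst : IsStationaryProcess g P) (hm : ∀ k, MemLp (g k) 2 P)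
    (hcov : ∃ l : ℝ, Tendsto (fun n : ℕ => ∑ k ∈ Finset.range n, cov[g 0, g (k : ℤ); P])
      atTop (𝓝 l)) :
    ∃ C : ℝ, 0 < C ∧ ∀ n : ℕ, Var[fun ω => ∑ k ∈ Finset.Icc 1 n, g (k : ℤ) ω; P] ≤ C * n := by
  obtain ⟨l, hl⟩ := hcov
  obtain ⟨D, hD⟩ := hl.bddAbove_range
  have hD' : ∀ n : ℕ, ∑ k ∈ Finset.range n, cov[g 0, g (k : ℤ); P] ≤ D := fun n => hD ⟨n, rfl⟩
  have hD0 : 0 ≤ D := by simpa using hD' 0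
  refine ⟨2 * D + 1, by linarith, fun n => ?_⟩
  induction n with
  | zero =>
    have h0 : (fun ω => ∑ k ∈ Finset.Icc 1 0, g ((k : ℕ) : ℤ) ω) = 0 := by
      ext ω
      simp
    rw [h0, variance_zero]
    simp
  | succ n ih =>
    have hGL : MemLp (fun ω => ∑ k ∈ Finset.Icc 1 n, g (k : ℤ) ω) 2 P :=
      memLp_finsetSum _ fun k _ => hm k
    have h1 : (fun ω => ∑ k ∈ Finset.Icc 1 (n + 1), g (k : ℤ) ω) =
        (fun ω => ∑ k ∈ Finset.Icc 1 n, g (k : ℤ) ω) + g ((n + 1 : ℕ) : ℤ) := by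
      ext ω
      rw [Finset.sum_Icc_succ_top (by omega)]
      rfl
    have h2 : cov[fun ω => ∑ k ∈ Finset.Icc 1 n, g (k : ℤ) ω, g ((n + 1 : ℕ) : ℤ); P] =
        ∑ k ∈ Finset.range n, cov[g 0, g ((k + 1 : ℕ) : ℤ); P] := by
      rw [covariance_fun_sum_left' (X := fun k : ℕ => g (k : ℤ)) (fun k _ => hm k) (hm _)]
      have h3 : ∀ k ∈ Finset.Icc 1 n, cov[g (k : ℤ), g ((n + 1 : ℕ) : ℤ); P] =
          cov[g 0, g ((n + 1 - k : ℕ) : ℤ); P] := by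
        intro k hk
        rw [Finset.mem_Icc] at hk
        rw [hst.covariance_eq hm, Nat.cast_sub (by omega)]
      rw [Finset.sum_congr rfl h3]
      refine Finset.sum_bij' (fun k _ => n - k) (fun k _ => n - k) ?_ ?_ ?_ ?_ ?_
      · intro k hk; simp only [Finset.mem_Icc, Finset.mem_range] at hk ⊢; omega
      · intro k hk; simp only [Finset.mem_Icc, Finset.mem_range] at hk ⊢; omega
      · intro k hk; simp only [Finset.mem_Icc] at hk; omega
      · intro k hk; simp only [Finset.mem_range] at hk; omega
      · intro k hk
        simp only [Finset.mem_Icc] at hk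
        rw [show n + 1 - k = n - k + 1 by omega]
    have h4 := hD' (n + 1)
    rw [Finset.sum_range_succ'] at h4
    have h5 : cov[g 0, g ((0 : ℕ) : ℤ); P] = Var[g ((n + 1 : ℕ) : ℤ); P] := by
      rw [← covariance_self (hm _).aestronglyMeasurable.aemeasurable,
        hst.covariance_eq hm ((n + 1 : ℕ) : ℤ), sub_self, Nat.cast_zero]
    have h6 : 0 ≤ Var[g ((n + 1 : ℕ) : ℤ); P] := variance_nonneg _ _
    rw [h1, variance_add hGL (hm _), h2]
    push_cast at *
    linarith

theorem measure_abs_sum_ge_le {P : Measure Ω} (hg : IsGaussianProcess g P)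
    (hc : ∀ k, ∫ ω, g k ω ∂P = 0)
    {C : ℝ} (hC0 : 0 < C)
    (hC : ∀ n : ℕ, Var[fun ω => ∑ k ∈ Finset.Icc 1 n, g (k : ℤ) ω; P] ≤ C * n)
    {x : ℝ} (hx : 0 ≤ x) (n : ℕ) :
    P.real {ω | x ≤ |∑ k ∈ Finset.Icc 1 n, g (k : ℤ) ω|} ≤
      2 * Real.exp (-x ^ 2 / (2 * (C * n))) := by
  set G : Ω → ℝ := fun ω => ∑ k ∈ Finset.Icc 1 n, g (k : ℤ) ω with hG
  have hlaw : HasGaussianLaw G P :=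
    (hg.comp_right (fun k : ℕ => (k : ℤ))).hasGaussianLaw_fun_sum (I := Finset.Icc 1 n)
  have hG0 : ∫ ω, G ω ∂P = 0 := by
    simp only [hG]
    rw [integral_finsetSum _ fun k _ => (hg.hasGaussianLaw_eval _).integrable]
    simp [hc]
  have hmap := hlaw.map_eq_gaussianReal
  rw [hG0] at hmap
  have hCn : 0 ≤ C * n := by positivity
  have hsub : HasSubgaussianMGF G (C * n).toNNReal P := by
    refine ⟨fun t => ?_, fun t => ?_⟩
    · have h1 := integrable_exp_mul_gaussianReal (μ := 0) (v := Var[G; P].toNNReal) t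
      rw [← hmap] at h1
      exact (integrable_map_measure (by fun_prop) hlaw.aemeasurable).1 h1
    · rw [mgf_gaussianReal hmap, Real.coe_toNNReal _ (variance_nonneg _ _)]
      have h2 : Var[G; P] * t ^ 2 ≤ C * n * t ^ 2 :=
        mul_le_mul_of_nonneg_right (hC n) (sq_nonneg t)
      refine Real.exp_le_exp.2 ?_
      rw [Real.coe_toNNReal _ hCn]
      linarith
  have h1 := hsub.measure_ge_le hx
  have h2 := hsub.neg.measure_ge_le hx
  have h3 : {ω | x ≤ |G ω|} = {ω | x ≤ G ω} ∪ {ω | x ≤ (-G) ω} := by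
    ext ω
    simp [le_abs]
  rw [h3]
  refine (measureReal_union_le _ _).trans ?_
  rw [Real.coe_toNNReal _ hCn] at h1 h2
  linarith

theorem summable_exp_neg_mul_rpow {b s : ℝ} (hb : 0 < b) (hs : 0 < s) :
    Summable fun n : ℕ => Real.exp (-b * (n : ℝ) ^ s) := by
  have h1 := (isLittleO_exp_neg_mul_rpow_atTop hb (-(2 / s))).comp_tendsto
    ((tendsto_rpow_atTop hs).comp tendsto_natCast_atTop_atTop)
  refine summable_of_isBigO_nat (Real.summable_nat_rpow.2 (by norm_num : (-2 : ℝ) < -1))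
    (h1.isBigO.congr_right fun n => ?_)
  simp only [Function.comp_apply]
  rw [← Real.rpow_mul (by positivity)]
  congr 1
  field_simp

/-- Over windows of length `ℓ n`, with `ℓ n` at least a power of `n`, the increments of the Gaussian
partial sums are eventually at most `δ ℓ n`. -/
theorem ae_eventually_increment_lt (hg : IsGaussianProcess g P) (hc : ∀ k, ∫ ω, g k ω ∂P = 0)
    (hst : IsStationaryProcess g P)
    (hcov : ∃ l : ℝ, Tendsto (fun n : ℕ => ∑ k ∈ Finset.range n, cov[g 0, g (k : ℤ); P])
      atTop (𝓝 l)) {δ s : ℝ} (hδ : 0 < δ) (hs : 0 < s) {ℓ : ℕ → ℕ}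
    (hℓ : ∀ᶠ n : ℕ in atTop, (n : ℝ) ^ s ≤ ℓ n) :
    ∀ᵐ ω ∂P, ∀ᶠ n : ℕ in atTop,
      |∑ k ∈ Finset.Icc 1 (ℓ n), g ((n : ℤ) + (k : ℤ)) ω| < δ * ℓ n := by
  obtain ⟨C, hC0, hC⟩ := exists_variance_sum_le hst
    (fun k => (hg.hasGaussianLaw_eval k).memLp_two) hcov
  have hle : ∀ n : ℕ, P {ω | δ * ℓ n ≤ |∑ k ∈ Finset.Icc 1 (ℓ n), g ((n : ℤ) + (k : ℤ)) ω|} ≤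
      ENNReal.ofReal (2 * Real.exp (-(δ ^ 2 / (2 * C)) * ℓ n)) := by
    intro n
    have hf : Measurable fun x : ℤ → ℝ => |∑ k ∈ Finset.Icc 1 (ℓ n), x (k : ℤ)| := by
      fun_prop
    have h1 := ((hst n).comp hf).measure_mem_eq (s := Set.Ici (δ * ℓ n)) measurableSet_Ici
    have h2 : {ω | δ * ℓ n ≤ |∑ k ∈ Finset.Icc 1 (ℓ n), g ((n : ℤ) + (k : ℤ)) ω|} =
        ((fun x : ℤ → ℝ => |∑ k ∈ Finset.Icc 1 (ℓ n), x (k : ℤ)|) ∘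
          fun ω (k : ℤ) => g (k + n) ω) ⁻¹' Set.Ici (δ * ℓ n) := by
      ext ω
      simp [add_comm]
    rw [h2, h1, ← ofReal_measureReal]
    refine ENNReal.ofReal_le_ofReal
      ((measure_abs_sum_ge_le hg hc hC0 hC (show 0 ≤ δ * ℓ n by positivity) (ℓ n)).trans_eq ?_)
    rcases Nat.eq_zero_or_pos (ℓ n) with h0 | h0
    · simp [h0]
    · have : (0 : ℝ) < ℓ n := by exact_mod_cast h0
      congr 2
      field_simp
  have hsum : ∑' n : ℕ,
      P {ω | δ * ℓ n ≤ |∑ k ∈ Finset.Icc 1 (ℓ n), g ((n : ℤ) + (k : ℤ)) ω|} ≠ ⊤ := by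
    have hb : 0 < δ ^ 2 / (2 * C) := by positivity
    have h3 : Summable fun n : ℕ => 2 * Real.exp (-(δ ^ 2 / (2 * C)) * ℓ n) := by
      refine Summable.mul_left 2 (summable_of_isBigO_nat (summable_exp_neg_mul_rpow hb hs)
        (Asymptotics.IsBigO.of_bound 1 ?_))
      filter_upwards [hℓ] with n hn
      rw [Real.norm_of_nonneg (Real.exp_nonneg _), Real.norm_of_nonneg (Real.exp_nonneg _), one_mul]
      exact Real.exp_le_exp.2 (by nlinarith)
    exact ne_top_of_le_ne_top h3.tsum_ofReal_lt_top.ne (ENNReal.tsum_le_tsum hle)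
  filter_upwards [ae_eventually_notMem hsum] with ω hω
  filter_upwards [hω] with n hn
  simpa using hn

end Gaussian

/-! ### The lower bound for the approximation error -/

/-- The window length `⌈(n log n)^{1/p}⌉`. -/
noncomputable def window (p : ℝ) (n : ℕ) : ℕ := ⌈((n : ℝ) * Real.log n) ^ (1 / p)⌉₊

theorem mul_log_nonneg (n : ℕ) : 0 ≤ (n : ℝ) * Real.log n :=
  mul_nonneg n.cast_nonneg (Real.log_natCast_nonneg n)

theorem one_le_log_of_three_le {x : ℝ} (hx : 3 ≤ x) : 1 ≤ Real.log x := by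
  rw [Real.le_log_iff_exp_le (by linarith)]
  linarith [Real.exp_one_lt_d9]

/-- An innovation exceeds the window at time `k` with probability of order at least
`1 / (k log k)`. -/
theorem exists_le_innovMass_tail_window (hp : 2 < p) : ∃ c : ℝ, 0 < c ∧ ∀ k : ℕ,
    c * (((k : ℝ) + 3) * Real.log ((k : ℝ) + 3))⁻¹ ≤
      ∑' i : ℕ, innovMass p (i + window p k + 1) := by
  obtain ⟨c, hc, h⟩ := exists_le_innovMass_tail hp
  refine ⟨c * 3 ^ (-p), by positivity, fun k => le_trans ?_ (h (window p k))⟩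
  have hk : (0 : ℝ) ≤ k := k.cast_nonneg
  have hlog : 1 ≤ Real.log ((k : ℝ) + 3) := one_le_log_of_three_le (by linarith)
  set y : ℝ := ((k : ℝ) + 3) * Real.log ((k : ℝ) + 3) with hy
  have hy1 : 1 ≤ y := by nlinarith
  have hle : (k : ℝ) * Real.log k ≤ y := by
    rcases Nat.eq_zero_or_pos k with rfl | hk0
    · simpa using zero_le_one.trans hy1
    · have : (0 : ℝ) < k := by exact_mod_cast hk0
      exact mul_le_mul (by linarith) (Real.log_le_log this (by linarith))
        (Real.log_natCast_nonneg k) (by linarith)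
  have hyp : 1 ≤ y ^ (1 / p) := Real.one_le_rpow hy1 (by positivity)
  have hw : (window p k : ℝ) + 1 ≤ 3 * y ^ (1 / p) := by
    have h1 : (window p k : ℝ) < ((k : ℝ) * Real.log k) ^ (1 / p) + 1 :=
      Nat.ceil_lt_add_one (Real.rpow_nonneg (mul_log_nonneg k) _)
    have h2 : ((k : ℝ) * Real.log k) ^ (1 / p) ≤ y ^ (1 / p) :=
      Real.rpow_le_rpow (mul_log_nonneg k) hle (by positivity)
    linarith
  have h3 : (3 * y ^ (1 / p)) ^ (-p) ≤ ((window p k : ℝ) + 1) ^ (-p) :=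
    Real.rpow_le_rpow_of_nonpos (by positivity) hw (by linarith)
  have h4 : (3 * y ^ (1 / p)) ^ (-p) = 3 ^ (-p) * y⁻¹ := by
    rw [Real.mul_rpow (by norm_num) (by positivity), ← Real.rpow_mul (by linarith),
      show 1 / p * -p = -1 by field_simp, Real.rpow_neg_one]
  rw [mul_assoc, ← h4]
  exact mul_le_mul_of_nonneg_left h3 hc.le

theorem summable_sq_inv_mul_log :
    Summable fun k : ℕ => ((((k : ℝ) + 3) * Real.log ((k : ℝ) + 3))⁻¹) ^ 2 := by
  have h := (summable_nat_add_iff 3).2 (Real.summable_nat_pow_inv.2 one_lt_two)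
  refine Summable.of_nonneg_of_le (fun k => by positivity) (fun k => ?_) h
  have hk : (0 : ℝ) ≤ k := k.cast_nonneg
  have hlog : 1 ≤ Real.log ((k : ℝ) + 3) := one_le_log_of_three_le (by linarith)
  push_cast
  rw [inv_pow]
  gcongr
  nlinarith

theorem antitone_inv_mul_log :
    Antitone fun k : ℕ => (((k : ℝ) + 3) * Real.log ((k : ℝ) + 3))⁻¹ := by
  intro m n hmn
  have hm : (0 : ℝ) ≤ m := m.cast_nonneg
  have h1 : (m : ℝ) ≤ n := by exact_mod_cast hmn
  have hlog : 1 ≤ Real.log ((m : ℝ) + 3) := one_le_log_of_three_le (by linarith)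
  have hlog' : Real.log ((m : ℝ) + 3) ≤ Real.log ((n : ℝ) + 3) :=
    Real.log_le_log (by linarith) (by linarith)
  have : 0 < ((m : ℝ) + 3) * Real.log ((m : ℝ) + 3) := by positivity
  simp only
  gcongr

theorem rpow_le_window {n : ℕ} (hn : 3 ≤ n) (hp : 2 < p) : (n : ℝ) ^ (1 / p) ≤ window p n := by
  have h3 : (3 : ℝ) ≤ n := by exact_mod_cast hn
  have hlog := one_le_log_of_three_le h3
  refine le_trans (Real.rpow_le_rpow (by positivity) ?_ (by positivity)) (Nat.le_ceil _)
  nlinarith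

theorem window_le (hp : 2 < p) {n : ℕ} (hn : 1 ≤ n) : window p n ≤ n := by
  have h1 : (1 : ℝ) ≤ n := by exact_mod_cast hn
  refine Nat.ceil_le.2 ?_
  calc ((n : ℝ) * Real.log n) ^ (1 / p) ≤ ((n : ℝ) ^ (2 : ℝ)) ^ (1 / p) := by
        refine Real.rpow_le_rpow (mul_log_nonneg n) ?_ (by positivity)
        rw [Real.rpow_two, sq]
        gcongr
        exact (Real.log_le_sub_one_of_pos (by linarith)).trans (by linarith)
    _ = (n : ℝ) ^ (2 * (1 / p)) := (Real.rpow_mul (by linarith) _ _).symm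
    _ ≤ (n : ℝ) ^ (1 : ℝ) := by
        refine Real.rpow_le_rpow_of_exponent_le h1 ?_
        rw [mul_one_div, div_le_one (by linarith)]
        exact hp.le
    _ = n := Real.rpow_one _

theorem mul_log_rpow_le_window (hp : 2 < p) {m n : ℕ} (hn : 2 ≤ n) (hm : m ≤ 2 * n) :
    ((m : ℝ) * Real.log m) ^ (1 / p) ≤ 4 * window p n := by
  have h2 : (2 : ℝ) ≤ n := by exact_mod_cast hn
  have hmn : (m : ℝ) ≤ 2 * n := by exact_mod_cast hm
  have hlog2 : Real.log m ≤ 2 * Real.log n := by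
    rcases Nat.eq_zero_or_pos m with rfl | hm0
    · simpa using Real.log_natCast_nonneg n
    · calc Real.log m ≤ Real.log ((n : ℝ) ^ 2) :=
            Real.log_le_log (by exact_mod_cast hm0) (by nlinarith)
        _ = 2 * Real.log n := by rw [Real.log_pow]; norm_num
  have h0 := mul_log_nonneg n
  have h1p : 1 / p ≤ 1 := by rw [div_le_one (by linarith)]; linarith
  calc ((m : ℝ) * Real.log m) ^ (1 / p) ≤ (4 * ((n : ℝ) * Real.log n)) ^ (1 / p) := by
        refine Real.rpow_le_rpow (mul_log_nonneg m) ?_ (by positivity)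
        calc (m : ℝ) * Real.log m ≤ (2 * n) * (2 * Real.log n) :=
              mul_le_mul hmn hlog2 (Real.log_natCast_nonneg m) (by positivity)
          _ = _ := by ring
    _ = 4 ^ (1 / p) * ((n : ℝ) * Real.log n) ^ (1 / p) := Real.mul_rpow (by norm_num) h0
    _ ≤ 4 * window p n := by
        refine mul_le_mul ?_ (Nat.le_ceil _) (Real.rpow_nonneg h0 _) (by norm_num)
        simpa using Real.rpow_le_rpow_of_exponent_le (show (1 : ℝ) ≤ 4 by norm_num) h1p

/-- A sequence which infinitely often moves by `δ ℓ_n` over a window of length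
`ℓ_n = ⌈(n log n)^{1/p}⌉` is infinitely often at least of order `(n log n)^{1/p}`, since one of the
two ends of the window is at distance `δ ℓ_n / 2` from `0`. -/
theorem limsup_pos_of_frequently (hp : 2 < p) {f : ℕ → ℝ} {δ : ℝ} (hδ : 0 < δ)
    (h : ∃ᶠ n in atTop, δ * window p n ≤ |f (n + window p n) - f n|) :
    0 < limsup (fun n : ℕ => ((((n : ℝ) * Real.log (n : ℝ)) ^ (-(1 / p)) * |f n| : ℝ) : EReal))
      atTop := by
  have key : ∃ᶠ n : ℕ in atTop, δ / 8 ≤ ((n : ℝ) * Real.log (n : ℝ)) ^ (-(1 / p)) * |f n| := by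
    rw [frequently_atTop] at h ⊢
    intro N
    obtain ⟨n, hn, hfn⟩ := h (max N 3)
    have hN : N ≤ n := (le_max_left _ _).trans hn
    have hn3 : 3 ≤ n := (le_max_right _ _).trans hn
    have hwn := window_le hp (show 1 ≤ n by omega)
    obtain ⟨m, hm1, hm2, hfm⟩ : ∃ m, n ≤ m ∧ m ≤ 2 * n ∧ δ * window p n / 2 ≤ |f m| := by
      by_contra! hcon
      have h1 := hcon n le_rfl (by omega)
      have h2 := hcon (n + window p n) (by omega) (by omega)
      have h3 := abs_sub (f (n + window p n)) (f n)
      linarith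
    refine ⟨m, hN.trans hm1, ?_⟩
    have hm3 : (3 : ℝ) ≤ m := by exact_mod_cast hn3.trans hm1
    have hlog := one_le_log_of_three_le hm3
    have hb : 0 < ((m : ℝ) * Real.log m) ^ (1 / p) := by positivity
    rw [Real.rpow_neg (mul_log_nonneg m), inv_mul_eq_div, le_div_iff₀ hb]
    have h4 := mul_log_rpow_le_window hp (show 2 ≤ n by omega) hm2
    nlinarith
  refine lt_of_lt_of_le (b := ((δ / 8 : ℝ) : EReal)) (by exact_mod_cast (by positivity : 0 < δ / 8))
    (le_limsup_of_frequently_le (key.mono fun n hn => ?_))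
  exact_mod_cast hn

/-- After a jump larger than `ℓ` at a visit to `0`, the chain avoids `0` for `ℓ` steps. -/
theorem chain_add_ne_zero (e : ℕ → ℕ) (w : ℕ) {n i ℓ : ℕ} (hn : chain e w n = 0) (hℓ : ℓ < e n)
    (hi1 : 1 ≤ i) (hi : i ≤ ℓ) : chain e w (n + i) ≠ 0 := by
  have h : ∀ j, j + 1 ≤ ℓ → chain e w (n + (j + 1)) = e n - (j + 1) := by
    intro j
    induction j with
    | zero => intro _; rw [zero_add, chain, hn, step, if_pos rfl]
    | succ j ih =>
      intro hj
      rw [← add_assoc, chain, ih (by omega), step, if_neg (by omega)]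
      omega
  obtain ⟨j, rfl⟩ := Nat.exists_eq_add_of_le' hi1
  rw [h j hi]
  omega

theorem sum_Icc_add_sub (f : ℕ → ℝ) (n ℓ : ℕ) :
    ∑ k ∈ Finset.Icc 1 (n + ℓ), f k - ∑ k ∈ Finset.Icc 1 n, f k =
      ∑ k ∈ Finset.Icc 1 ℓ, f (n + k) := by
  induction ℓ with
  | zero => simp
  | succ ℓ ih =>
    rw [← add_assoc, Finset.sum_Icc_succ_top (by omega), Finset.sum_Icc_succ_top (by omega), ← ih]
    ring_nf

theorem statMass_zero_pos (hp : 2 < p) : 0 < statMass p 0 := by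
  have h := mean_pos hp
  have h1 := (hasSum_innovMass hp).tsum_eq
  simp only [statMass, add_zero, h1]
  positivity

theorem ae_limsup_pos (hp : 2 < p) {Ω : Type*} [MeasurableSpace Ω] {P : Measure Ω}
    [IsProbabilityMeasure P] {ξ : ℕ → Ω → ℕ} {W₀ : Ω → ℕ} (hξ : ∀ i, Measurable (ξ i))
    (hlaw : ∀ i k : ℕ, P.real {ω | ξ i ω = k} = innovMass p k) (hind : iIndepFun ξ P)
    (hW : Measurable W₀) (hWξ : IndepFun W₀ (fun ω i => ξ i ω) P) {g : ℤ → Ω → ℝ}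
    (hg : IsGaussianProcess g P) (hc : ∀ k, ∫ ω, g k ω ∂P = 0) (hst : IsStationaryProcess g P)
    (hcov : ∃ l : ℝ, Tendsto (fun n : ℕ => ∑ k ∈ Finset.range n, cov[g 0, g (k : ℤ); P])
      atTop (𝓝 l)) :
    ∀ᵐ ω ∂P, 0 < limsup
      (fun n : ℕ => ((((n : ℝ) * Real.log (n : ℝ)) ^ (-(1 / p)) *
        |∑ k ∈ Finset.Icc 1 n,
            ((if chain (fun i => ξ i ω) (W₀ ω) k = 0 then (1 : ℝ) else 0) - statMass p 0)
          - ∑ k ∈ Finset.Icc 1 n, g (k : ℤ) ω| : ℝ) : EReal)) atTop := by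
  have hν := statMass_zero_pos hp
  obtain ⟨c, hc0, hq⟩ := exists_le_innovMass_tail_window hp
  have hpos : ∀ k : ℕ, 0 ≤ (((k : ℝ) + 3) * Real.log ((k : ℝ) + 3))⁻¹ := fun k => by
    have := one_le_log_of_three_le (show (3 : ℝ) ≤ k + 3 by linarith [k.cast_nonneg (α := ℝ)])
    positivity
  filter_upwards [ae_frequently_large_jump hp hξ hlaw hind hW hWξ hpos antitone_inv_mul_log
      summable_sq_inv_mul_log not_summable_inv_mul_log hc0 hq,
    ae_eventually_increment_lt hg hc hst hcov (half_pos hν) (show 0 < 1 / p by positivity)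
      (ℓ := window p) (by filter_upwards [eventually_ge_atTop 3] with n hn
                          exact rpow_le_window hn hp)] with ω h1 h2
  refine limsup_pos_of_frequently hp (f := fun n => ∑ k ∈ Finset.Icc 1 n,
    ((if chain (fun i => ξ i ω) (W₀ ω) k = 0 then (1 : ℝ) else 0) - statMass p 0)
      - ∑ k ∈ Finset.Icc 1 n, g (k : ℤ) ω) (half_pos hν) ((h1.and_eventually h2).mono ?_)
  rintro n ⟨⟨hn, hjump⟩, hinc⟩
  set ℓ := window p n with hℓ
  have h3 := sum_Icc_add_sub (fun k => (if chain (fun i => ξ i ω) (W₀ ω) k = 0 then (1 : ℝ) else 0)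
    - statMass p 0) n ℓ
  have h4 := sum_Icc_add_sub (fun k => g (k : ℤ) ω) n ℓ
  -- within the window the chain does not visit `0`
  have h5 : ∑ k ∈ Finset.Icc 1 ℓ, ((if chain (fun i => ξ i ω) (W₀ ω) (n + k) = 0 then (1 : ℝ)
      else 0) - statMass p 0) = -(statMass p 0 * ℓ) := by
    rw [Finset.sum_congr rfl (g := fun _ => -statMass p 0) fun k hk => ?_]
    · simp [mul_comm]
    · rw [Finset.mem_Icc] at hk
      rw [if_neg (chain_add_ne_zero _ _ hn hjump hk.1 hk.2), zero_sub]
  rw [h5] at h3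
  push_cast at h4
  rw [← h4] at hinc
  rw [abs_lt] at hinc
  rw [abs_sub_comm]
  refine le_trans ?_ (le_abs_self _)
  linarith [hinc.1, hinc.2]

end DiscreteChain

theorem mainTheorem9 {p : ℝ} (hp : 2 < p)
    {Ω : Type*} [MeasurableSpace Ω] (P : MeasureTheory.Measure Ω)
    [MeasureTheory.IsProbabilityMeasure P]
    -- the i.i.d. innovations
    (ξ : ℕ → Ω → ℕ) (hξ_meas : ∀ i, Measurable (ξ i))
    (hξ_law : ∀ i k : ℕ, 1 ≤ k → P.real {ω | ξ i ω = k} = DiscreteChain.innovMass p k)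
    (hξ_indep : ProbabilityTheory.iIndepFun ξ P) :
    -- the meeting time of two chains with independent stationary starting points
    (∀ W₀ W₀' : Ω → ℕ, Measurable W₀ → Measurable W₀' →
      (∀ j, P.real {ω | W₀ ω = j} = DiscreteChain.statMass p j) →
      (∀ j, P.real {ω | W₀' ω = j} = DiscreteChain.statMass p j) →
      ProbabilityTheory.IndepFun W₀ (fun ω i => ξ i ω) P →
      ProbabilityTheory.IndepFun W₀' (fun ω => (W₀ ω, fun i => ξ i ω)) P →
      (∑' n : ℕ, ENNReal.ofReal (((n : ℝ) + 1) ^ (p - 2)) *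
          P {ω | ((n + 1 : ℕ) : ℕ∞) ≤
            DiscreteChain.meetTime (fun i => ξ i ω) (W₀ ω) (W₀' ω)} = ⊤) ∧
      (∀ ε : ℝ, 0 < ε →
        ∑' n : ℕ, ENNReal.ofReal
            (((n : ℝ) + 2) ^ (p - 2) * Real.log ((n : ℝ) + 2) ^ (-(1 + ε))) *
          P {ω | ((n + 2 : ℕ) : ℕ∞) ≤
            DiscreteChain.meetTime (fun i => ξ i ω) (W₀ ω) (W₀' ω)} < ⊤)) ∧
    -- the lower bound for the Gaussian approximation, for an arbitrary initial law
    (∀ W₀ : Ω → ℕ, Measurable W₀ →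
      ProbabilityTheory.IndepFun W₀ (fun ω i => ξ i ω) P →
      ∀ g : ℤ → Ω → ℝ,
        ProbabilityTheory.IsGaussianProcess g P →
        (∀ k, ∫ ω, g k ω ∂P = 0) →
        DiscreteChain.IsStationaryProcess g P →
        (∃ l : ℝ, Filter.Tendsto
          (fun n : ℕ => ∑ k ∈ Finset.range n, ProbabilityTheory.covariance (g 0) (g (k : ℤ)) P)
          Filter.atTop (nhds l)) →
        ∀ᵐ ω ∂P, 0 < Filter.limsup
          (fun n : ℕ => ((((n : ℝ) * Real.log (n : ℝ)) ^ (-(1 / p)) *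
            |∑ k ∈ Finset.Icc 1 n,
                ((if DiscreteChain.chain (fun i => ξ i ω) (W₀ ω) k = 0 then (1 : ℝ) else 0)
                  - DiscreteChain.statMass p 0)
              - ∑ k ∈ Finset.Icc 1 n, g (k : ℤ) ω| : ℝ) : EReal))
          Filter.atTop) := by
  have hlaw : ∀ i k : ℕ, P.real {ω | ξ i ω = k} = DiscreteChain.innovMass p k := fun i =>
    DiscreteChain.innov_law hp (hξ_meas i) (hξ_law i)
  refine ⟨fun W₀ W₀' hW hW' hl hl' hWξ hWξ' => ⟨?_, fun ε hε => ?_⟩,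
    fun W₀ hW hWξ g hg hc hst hcov => ?_⟩
  · exact DiscreteChain.tsum_meetTime_eq_top hp hξ_meas hlaw hW hW' hl hl' hWξ hWξ'
  · exact DiscreteChain.tsum_meetTime_lt_top hp hξ_meas hlaw hξ_indep hW hW' hl hl' hWξ hWξ' hε
  · exact DiscreteChain.ae_limsup_pos hp hξ_meas hlaw hξ_indep hW hWξ hg hc hst hcov
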